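/- Let $\mathfrak g$ be a finite-dimensional complex simple Lie algebra, $\mathfrak h$ a Cartan subalgebra, $\Delta^+$ a positive root system with maximal root $\theta$ (the highest weight of the adjoint representation), $\mathfrak n=\bigoplus_{\alpha\in\Delta^+}\mathfrak g_\alpha$, $\overline{\mathfrak n}=\bigoplus_{\alpha\in\Delta^+}\mathfrak g_{-\alpha}$, $\mathfrak b=\mathfrak h\oplus\mathfrak n$ and $\rho=\frac12\sum_{\alpha\in\Delta^+}\alpha$. Let $U(\mathfrak g)$ be the universal enveloping algebra and $\mathfrak Z(\mathfrak g)$ its center. Let $p\colon U(\mathfrak g)\to U(\mathfrak h)$ be the projection along $U(\mathfrak g)=U(\mathfrak h)\oplus(\overline{\mathfrak n}\,U(\mathfrak g)+U(\mathfrak g)\,\mathfrak n)$, let $s$ be the algebra automorphism of $U(\mathfrak h)$ with $s(h)=h-\rho(h)$ for $h\in\mathfrak h$, and for $\mu\in\mathfrak h^*$ and $z\in\mathfrak Z(\mathfrak g)$ put $\chi_\mu(z)=(s(p(z)))(\mu)$, where $U(\mathfrak h)=S(\mathfrak h)$ is identified with the algebra of polynomial functions on $\mathfrak h^*$. Let $\{f_\alpha;\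 \alpha\in\Delta^+\}$ with $f_\alpha\in\mathfrak g_{-\alpha}$ be a basis of $\overline{\mathfrak n}$, let $x_\alpha$ be the corresponding linear coordinates on $\overline{\mathfrak n}$, let $\mathcal A$ be the Weyl algebra generated by $x_\alpha,\partial_{x_\alpha}$, $\alpha\in\Delta^+$, and let $u(x)=\sum_{\alpha\in\Delta^+}x_\alpha f_\alpha\in\mathbb C[x]\otimes\mathfrak g$. For $\mu\in\mathfrak h^*$ and $a\in\mathfrak g$ put $$\pi_\mu(a)=-\sum_{\alpha\in\Delta^+}\Big[\frac{\operatorname{ad}(u(x))\,e^{\operatorname{ad}(u(x))}}{e^{\operatorname{ad}(u(x))}-\operatorname{id}}\,\big(e^{-\operatorname{ad}(u(x))}a\big)_{\overline{\mathfrak n}}\Big]_\alpha\partial_{x_\alpha}+(\mu+\rho)\big((e^{-\operatorname{ad}(u(x))}a)_{\mathfrak h}\big)\in\mathcal A,$$ where $[\,\cdot\,]_\alpha$ is the $\alpha$-th coordinate with respect to $\{f_\alpha\}$ and the subscripts $\overline{\mathfrak n}$ and $\mathfrak h$ denote the components with respect to $\mathfrak g=\overline{\mathfrak n}\oplus\mathfrak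 h\oplus\mathfrak n$. Let $\lambda\in\mathfrak h^*$. Then $\pi_{\lambda+\rho}\colon\mathfrak g\to\mathcal A$ is a homomorphism of Lie algebras, so that $W^{\mathfrak g}_{\mathfrak b}(\lambda)=\mathcal A/\mathcal I$, where $\mathcal I$ is the left ideal of $\mathcal A$ generated by $\partial_{x_\theta}$ and by the $x_\alpha$ with $\alpha\in\Delta^+\setminus\{\theta\}$, is a $\mathfrak g$-module through $\pi_{\lambda+\rho}$, and $$zv=\chi_{\lambda+\rho}(z)\,v\qquad\text{for all } z\in\mathfrak Z(\mathfrak g)\text{ and } v\in W^{\mathfrak g}_{\mathfrak b}(\lambda).$$ The center acts by the same character on the Verma module $M^{\mathfrak g}_{\mathfrak b}(\lambda)=U(\mathfrak g)\otimes_{U(\mathfrak b)}\mathbb C_\lambda$: $zv=\chi_{\lambda+\rho}(z)v$ for all $z\in\mathfrak Z(\mathfrak g)$ and $v\in M^{\mathfrak g}_{\mathfrak b}(\lambda)$. -/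

import Mathlib

open scoped TensorProduct

attribute [local instance 100] LieRing.ofAssociativeRing

noncomputable section

/-! ### Weyl algebras -/

/-- The canonical commutation relations between the generators `x i` (the letters `Sum.inl i`) and
`∂ i` (the letters `Sum.inr i`). -/
inductive WeylRel (ι : Type*) : FreeAlgebra ℂ (ι ⊕ ι) → FreeAlgebra ℂ (ι ⊕ ι) → Prop
  | x_comm (i j : ι) : WeylRel ι
      (FreeAlgebra.ι ℂ (Sum.inl i) * FreeAlgebra.ι ℂ (Sum.inl j))
      (FreeAlgebra.ι ℂ (Sum.inl j) * FreeAlgebra.ι ℂ (Sum.inl i))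
  | d_comm (i j : ι) : WeylRel ι
      (FreeAlgebra.ι ℂ (Sum.inr i) * FreeAlgebra.ι ℂ (Sum.inr j))
      (FreeAlgebra.ι ℂ (Sum.inr j) * FreeAlgebra.ι ℂ (Sum.inr i))
  | d_x_self (i : ι) : WeylRel ι
      (FreeAlgebra.ι ℂ (Sum.inr i) * FreeAlgebra.ι ℂ (Sum.inl i))
      (FreeAlgebra.ι ℂ (Sum.inl i) * FreeAlgebra.ι ℂ (Sum.inr i) + 1)
  | d_x_ne (i j : ι) (hij : i ≠ j) : WeylRel ι
      (FreeAlgebra.ι ℂ (Sum.inr i) * FreeAlgebra.ι ℂ (Sum.inl j))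
      (FreeAlgebra.ι ℂ (Sum.inl j) * FreeAlgebra.ι ℂ (Sum.inr i))

/-- The complex Weyl algebra in the variables `x i`, `∂ i`, `i : ι`. -/
def WeylAlg (ι : Type*) : Type _ := RingQuot (WeylRel ι)

instance (ι : Type*) : Ring (WeylAlg ι) := inferInstanceAs (Ring (RingQuot (WeylRel ι)))

instance (ι : Type*) : Algebra ℂ (WeylAlg ι) :=
  inferInstanceAs (Algebra ℂ (RingQuot (WeylRel ι)))

namespace WeylAlg

variable {ι : Type*}

/-- The generator `x i`. -/
def x (i : ι) : WeylAlg ι := RingQuot.mkAlgHom ℂ (WeylRel ι) (FreeAlgebra.ι ℂ (Sum.inl i))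

/-- The generator `∂ i`. -/
def d (i : ι) : WeylAlg ι := RingQuot.mkAlgHom ℂ (WeylRel ι) (FreeAlgebra.ι ℂ (Sum.inr i))

theorem x_mul_x (i j : ι) : (x i * x j : WeylAlg ι) = x j * x i := by
  have h := RingQuot.mkAlgHom_rel ℂ (WeylRel.x_comm i j)
  rw [map_mul, map_mul] at h
  exact h

theorem d_mul_d (i j : ι) : (d i * d j : WeylAlg ι) = d j * d i := by
  have h := RingQuot.mkAlgHom_rel ℂ (WeylRel.d_comm i j)
  rw [map_mul, map_mul] at h
  exact h

theorem d_mul_x_self (i : ι) : (d i * x i : WeylAlg ι) = x i * d i + 1 := by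
  have h := RingQuot.mkAlgHom_rel ℂ (WeylRel.d_x_self i)
  rw [map_add, map_mul, map_mul, map_one] at h
  exact h

theorem d_mul_x_of_ne {i j : ι} (hij : i ≠ j) : (d i * x j : WeylAlg ι) = x j * d i := by
  have h := RingQuot.mkAlgHom_rel ℂ (WeylRel.d_x_ne i j hij)
  rw [map_mul, map_mul] at h
  exact h

/-- The monomial `∏ x i ^ (m i)`; the factors commute. -/
def xMonomial (m : ι →₀ ℕ) : WeylAlg ι :=
  m.support.noncommProd (fun i => x i ^ m i)
    (fun i _ j _ _ => Commute.pow_pow (x_mul_x i j) (m i) (m j))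

/-- The linear embedding of the polynomials in the `x i` into the Weyl algebra. -/
def ofPoly : MvPolynomial ι ℂ →ₗ[ℂ] WeylAlg ι :=
  (MvPolynomial.basisMonomials ι ℂ).constr ℂ xMonomial

end WeylAlg

/-! ### Triangular decomposition -/

section Triangular

variable {𝔤 : Type*} [LieRing 𝔤] [LieAlgebra ℂ 𝔤] [FiniteDimensional ℂ 𝔤]
  [LieAlgebra.IsKilling ℂ 𝔤]
  {H : LieSubalgebra ℂ 𝔤} [H.IsCartanSubalgebra]

/-- The set `Δ⁺` of the roots that are positive with respect to the base `b`. -/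
abbrev PosRoot (b : (LieAlgebra.IsKilling.rootSystem H).Base) : Type _ :=
  {α : H.root // b.IsPos α}

instance (b : (LieAlgebra.IsKilling.rootSystem H).Base) : Fintype (PosRoot b) :=
  Fintype.ofFinite _

variable (b : (LieAlgebra.IsKilling.rootSystem H).Base)

/-- A positive root as a linear functional on the Cartan subalgebra. -/
def rootFun (α : PosRoot b) : Module.Dual ℂ H := LieAlgebra.IsKilling.rootSystem H |>.root α.1

/-- The nilradical `𝔫`, the sum of the root spaces of the positive roots. -/
def nPlus : Submodule ℂ 𝔤 :=
  ⨆ α : PosRoot b, (LieAlgebra.rootSpace H (rootFun b α)).toSubmodule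

/-- The opposite nilradical `𝔫̄`, the sum of the root spaces of the negative roots. -/
def nMinus : Submodule ℂ 𝔤 :=
  ⨆ α : PosRoot b, (LieAlgebra.rootSpace H (-rootFun b α : Module.Dual ℂ H)).toSubmodule

/-- The Weyl vector, half the sum of the positive roots. -/
def weylVector : Module.Dual ℂ H := (1 / 2 : ℂ) • ∑ α : PosRoot b, rootFun b α

/-- `θ` is the maximal root: it is the highest weight of the adjoint representation, that is, its
root space is annihilated by all the root spaces of the positive roots. -/
def IsMaximalRoot (θ : PosRoot b) : Prop :=
  ∀ α : PosRoot b, ∀ y ∈ LieAlgebra.rootSpace H (rootFun b α),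
    ∀ v ∈ LieAlgebra.rootSpace H (rootFun b θ), ⁅y, v⁆ = 0

theorem rootFun_coe (α : PosRoot b) : (rootFun b α : H → ℂ) = (α.1.1 : H → ℂ) := rfl

theorem rootFun_ne_zero (α : PosRoot b) : (rootFun b α : H → ℂ) ≠ 0 := by
  intro h
  exact (LieAlgebra.IsKilling.rootSystem H).ne_zero α.1 (DFunLike.coe_injective h)

theorem neg_rootFun_ne (α β : PosRoot b) : -rootFun b α ≠ rootFun b β := by
  intro h
  let P := LieAlgebra.IsKilling.rootSystem H
  let := P.indexNeg
  have h1 : P.root (-α.1) = P.root β.1 := by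
    have h3 : P.root (-α.1) = -P.root α.1 := by simp
    rw [h3]
    exact h
  have h2 : -α.1 = β.1 := P.root.injective h1
  exact (RootPairing.Base.IsPos.neg_iff_not b α.1).mp (h2 ▸ β.2) α.2

theorem triangular_aux :
    ∃ S T : Set (H → ℂ), Disjoint S T ∧ (0 : H → ℂ) ∉ S ∧ (0 : H → ℂ) ∉ T ∧
      nMinus b = ⨆ χ ∈ S, (LieAlgebra.rootSpace H χ).toSubmodule ∧
      nPlus b = ⨆ χ ∈ T, (LieAlgebra.rootSpace H χ).toSubmodule ∧
      H.toSubmodule = ⨆ χ ∈ ({0} : Set (H → ℂ)), (LieAlgebra.rootSpace H χ).toSubmodule ∧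
      nMinus b ⊔ (H.toSubmodule ⊔ nPlus b) = ⊤ := by
  have hH : (LieAlgebra.rootSpace H (0 : H → ℂ)).toSubmodule = H.toSubmodule := by
    rw [LieAlgebra.rootSpace_zero_eq]; rfl
  refine ⟨Set.range fun α : PosRoot b => ((-rootFun b α : Module.Dual ℂ H) : H → ℂ),
    Set.range fun α : PosRoot b => (rootFun b α : H → ℂ), ?_, ?_, ?_, ?_, ?_, ?_, ?_⟩
  · rw [Set.disjoint_left]
    rintro _ ⟨α, rfl⟩ ⟨β, hβ⟩
    exact neg_rootFun_ne b α β (DFunLike.coe_injective hβ.symm)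
  · rintro ⟨α, hα⟩
    apply rootFun_ne_zero b α
    have : -rootFun b α = 0 := DFunLike.coe_injective hα
    rw [neg_eq_zero.mp this]; rfl
  · rintro ⟨α, hα⟩
    exact rootFun_ne_zero b α hα
  · rw [iSup_range]; rfl
  · rw [iSup_range]; rfl
  · rw [iSup_singleton, hH]
  · have htop : (⨆ χ : LieModule.Weight ℂ H 𝔤, (LieModule.genWeightSpace 𝔤 χ).toSubmodule) = ⊤ := by
      rw [← LieSubmodule.iSup_toSubmodule, LieModule.iSup_genWeightSpace_eq_top' ℂ H 𝔤]; rfl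
    rw [eq_top_iff, ← htop]
    refine iSup_le fun χ => ?_
    by_cases hχ : χ.IsZero
    · have : (χ : H → ℂ) = 0 := hχ
      rw [this]
      exact hH.le.trans (le_sup_left.trans le_sup_right)
    · let P := LieAlgebra.IsKilling.rootSystem H
      let := P.indexNeg
      let r : H.root := ⟨χ, by simpa using hχ⟩
      rcases RootPairing.Base.IsPos.or_neg b r with hr | hr
      · exact (le_iSup (fun α : PosRoot b =>
          (LieAlgebra.rootSpace H (rootFun b α)).toSubmodule) ⟨r, hr⟩).trans
            (le_sup_right.trans le_sup_right)
      · have h1 : P.root (-r) = -P.root r := by simp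
        have h2 : ((-rootFun b ⟨-r, hr⟩ : Module.Dual ℂ H) : H → ℂ) = χ := by
          have : -rootFun b ⟨-r, hr⟩ = P.root r := by
            change -(P.root (-r)) = P.root r
            rw [h1, neg_neg]
          rw [this]; rfl
        have h3 := le_iSup (fun α : PosRoot b =>
          (LieAlgebra.rootSpace H (-rootFun b α : Module.Dual ℂ H)).toSubmodule) ⟨-r, hr⟩
        rw [h2] at h3
        exact h3.trans le_sup_left

theorem rootFam_disjoint {S T : Set (H → ℂ)} (h : Disjoint S T) :
    Disjoint (⨆ χ ∈ S, (LieAlgebra.rootSpace H χ).toSubmodule)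
      (⨆ χ ∈ T, (LieAlgebra.rootSpace H χ).toSubmodule) :=
  (LieSubmodule.iSupIndep_toSubmodule.mpr
    (LieModule.iSupIndep_genWeightSpace ℂ H 𝔤)).disjoint_biSup_biSup h

theorem isCompl_nMinus : IsCompl (nMinus b) (H.toSubmodule ⊔ nPlus b) := by
  obtain ⟨S, T, hST, hS, hT, h1, h2, h3, h4⟩ := triangular_aux b
  refine ⟨?_, codisjoint_iff.mpr h4⟩
  rw [h1, h2, h3, ← iSup_union]
  apply rootFam_disjoint
  rw [Set.disjoint_union_right]
  exact ⟨by simpa using hS, hST⟩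

theorem isCompl_cartan : IsCompl H.toSubmodule (nMinus b ⊔ nPlus b) := by
  obtain ⟨S, T, hST, hS, hT, h1, h2, h3, h4⟩ := triangular_aux b
  refine ⟨?_, codisjoint_iff.mpr (by rw [sup_left_comm]; exact h4)⟩
  rw [h1, h2, h3, ← iSup_union]
  apply rootFam_disjoint
  rw [Set.disjoint_union_right]
  exact ⟨by simpa using hS, by simpa using hT⟩

/-- The projection `a ↦ a_𝔫̄` along the triangular decomposition `𝔤 = 𝔫̄ ⊕ 𝔥 ⊕ 𝔫`. -/
def projMinus : 𝔤 →ₗ[ℂ] nMinus b := (nMinus b).projectionOnto _ (isCompl_nMinus b)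

/-- The projection `a ↦ a_𝔥` along the triangular decomposition `𝔤 = 𝔫̄ ⊕ 𝔥 ⊕ 𝔫`. -/
def projCartan : 𝔤 →ₗ[ℂ] H := H.toSubmodule.projectionOnto _ (isCompl_cartan b)

/-! ### The realization by differential operators -/

/-- The polynomial functions `ℂ[𝔫̄] = ℂ[x]` in the coordinates `x α`. -/
abbrev PolyN : Type _ := MvPolynomial (PosRoot b) ℂ

/-- The value at a nilpotent endomorphism `T` of the power series `F` with complex coefficients. -/
def evalNilpotent {R M : Type*} [CommRing R] [Algebra ℂ R] [AddCommGroup M] [Module R M]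
    (F : PowerSeries ℂ) (T : Module.End R M) : Module.End R M :=
  ∑ n ∈ Finset.range (nilpotencyClass T), algebraMap ℂ R (PowerSeries.coeff n F) • T ^ n

section Realization

variable (f : Module.Basis (PosRoot b) ℂ (nMinus b))

/-- The element `u(x) = ∑ x α ⊗ f α` of `ℂ[x] ⊗ 𝔤`. -/
def uElt : PolyN b ⊗[ℂ] 𝔤 := ∑ α : PosRoot b, (MvPolynomial.X α : PolyN b) ⊗ₜ[ℂ] (f α : 𝔤)

/-- The operator `ad (u(x))` on `ℂ[x] ⊗ 𝔤`. -/
def adU : Module.End (PolyN b) (PolyN b ⊗[ℂ] 𝔤) :=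
  LieAlgebra.ad (PolyN b) (PolyN b ⊗[ℂ] 𝔤) (uElt b f)

/-- The element `e^{-ad u(x)} a` of `ℂ[x] ⊗ 𝔤`. -/
def expNegAdU (a : 𝔤) : PolyN b ⊗[ℂ] 𝔤 :=
  evalNilpotent (PowerSeries.exp ℂ) (-adU b f) (1 ⊗ₜ[ℂ] a)

/-- The `α`-th coordinate of the `𝔫̄`-part of an element of `ℂ[x] ⊗ 𝔤`. -/
def coordMinus (α : PosRoot b) : PolyN b ⊗[ℂ] 𝔤 →ₗ[PolyN b] PolyN b :=
  Module.Dual.baseChange (PolyN b) (f.coord α ∘ₗ projMinus b)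

/-- The `𝔫̄`-part of an element of `ℂ[x] ⊗ 𝔤`, as an element of `ℂ[x] ⊗ 𝔤`. -/
def partMinus : PolyN b ⊗[ℂ] 𝔤 →ₗ[PolyN b] PolyN b ⊗[ℂ] 𝔤 :=
  ((nMinus b).subtype ∘ₗ projMinus b).baseChange (PolyN b)

/-- The operator `π_μ(a)` in the Weyl algebra of `𝔫̄`. The power series `bernoulli'PowerSeries` is
`z e^z / (e^z - 1)`. -/
def piOp (μ : Module.Dual ℂ H) (a : 𝔤) : WeylAlg (PosRoot b) :=
  -∑ α : PosRoot b,
      WeylAlg.ofPoly (coordMinus b f α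
        (evalNilpotent (bernoulli'PowerSeries ℂ) (adU b f) (partMinus b (expNegAdU b f a)))) *
      WeylAlg.d α +
    WeylAlg.ofPoly (Module.Dual.baseChange (PolyN b) ((μ + weylVector b) ∘ₗ projCartan b) (expNegAdU b f a))

end Realization

/-- The left ideal `(x α, α ≠ θ; ∂ θ)` of the Weyl algebra. -/
def idealGT (θ : PosRoot b) : Submodule (WeylAlg (PosRoot b)) (WeylAlg (PosRoot b)) :=
  Submodule.span _ ({w | ∃ α, α ≠ θ ∧ w = WeylAlg.x α} ∪ {WeylAlg.d θ})

/-- The vector space `W(λ)`, a left module over the Weyl algebra; `𝔤` acts on it through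
`π_{λ+ρ}`. -/
abbrev WModule (θ : PosRoot b) : Type _ := WeylAlg (PosRoot b) ⧸ idealGT b θ

/-! ### The Harish-Chandra homomorphism, central characters and Verma modules -/

/-- The algebra homomorphism from `U(𝔥)` to a complex algebra that is given on `𝔥` by a linear map
with commuting values. -/
def liftCartan {A : Type*} [Ring A] [Algebra ℂ A] (φ : H →ₗ[ℂ] A)
    (hφ : ∀ h h' : H, Commute (φ h) (φ h')) : UniversalEnvelopingAlgebra ℂ H →ₐ[ℂ] A :=
  UniversalEnvelopingAlgebra.lift ℂ
    { φ with
      map_lie' := fun {h h'} => by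
        rw [trivial_lie_zero H H h h', LieRing.of_associative_ring_bracket]
        change φ 0 = φ h * φ h' - φ h' * φ h
        rw [map_zero, (hφ h h').eq, sub_self] }

/-- The homomorphism `U(𝔥) → U(𝔤)` induced by the inclusion. -/
def cartanIncl : UniversalEnvelopingAlgebra ℂ H →ₐ[ℂ] UniversalEnvelopingAlgebra ℂ 𝔤 :=
  UniversalEnvelopingAlgebra.lift ℂ ((UniversalEnvelopingAlgebra.ι ℂ).comp H.incl)

/-- The subspace `𝔫̄ U(𝔤) + U(𝔤) 𝔫` of `U(𝔤)`. -/
def hcComplement : Submodule ℂ (UniversalEnvelopingAlgebra ℂ 𝔤) :=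
  Submodule.span ℂ
    ({w | ∃ y ∈ nMinus b, ∃ u, w = UniversalEnvelopingAlgebra.ι ℂ y * u} ∪
      {w | ∃ y ∈ nPlus b, ∃ u, w = u * UniversalEnvelopingAlgebra.ι ℂ y})

/-- The projection `p : U(𝔤) → U(𝔥)` along `U(𝔤) = U(𝔥) ⊕ (𝔫̄ U(𝔤) + U(𝔤) 𝔫)`: the value at `u` is
the element `s` of `U(𝔥)` with `u - s ∈ 𝔫̄ U(𝔤) + U(𝔤) 𝔫`. -/
def hcProj (u : UniversalEnvelopingAlgebra ℂ 𝔤) : UniversalEnvelopingAlgebra ℂ H :=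
  Classical.epsilon fun s => u - cartanIncl s ∈ hcComplement b

/-- The algebra endomorphism of `U(𝔥)` with `h ↦ h - ρ(h)`. -/
def rhoShift : UniversalEnvelopingAlgebra ℂ H →ₐ[ℂ] UniversalEnvelopingAlgebra ℂ H :=
  liftCartan
    ((UniversalEnvelopingAlgebra.ι ℂ : H →ₗ⁅ℂ⁆ UniversalEnvelopingAlgebra ℂ H).toLinearMap -
      (Algebra.linearMap ℂ (UniversalEnvelopingAlgebra ℂ H)) ∘ₗ weylVector b)
    (fun h h' => by
      have h0 : Commute (UniversalEnvelopingAlgebra.ι ℂ h)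
          (UniversalEnvelopingAlgebra.ι ℂ h' : UniversalEnvelopingAlgebra ℂ H) := by
        have := (UniversalEnvelopingAlgebra.ι ℂ :
          H →ₗ⁅ℂ⁆ UniversalEnvelopingAlgebra ℂ H).map_lie h h'
        rw [trivial_lie_zero H H h h', map_zero, LieRing.of_associative_ring_bracket] at this
        exact (sub_eq_zero.mp this.symm)
      exact ((h0.sub_right (Algebra.commutes (weylVector b h') _).symm).sub_left
        (Algebra.commutes (weylVector b h) _)))

/-- The value at `μ ∈ 𝔥*` of an element of `U(𝔥) = S(𝔥)`, seen as a polynomial function on `𝔥*`. -/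
def evalDual (μ : Module.Dual ℂ H) : UniversalEnvelopingAlgebra ℂ H →ₐ[ℂ] ℂ :=
  liftCartan μ (fun _ _ => Commute.all _ _)

/-- The Harish-Chandra homomorphism `γ` on the center of `U(𝔤)`. -/
def harishChandra (z : Subalgebra.center ℂ (UniversalEnvelopingAlgebra ℂ 𝔤)) :
    UniversalEnvelopingAlgebra ℂ H :=
  rhoShift b (hcProj b z)

/-- The central character `χ_μ`, `χ_μ(z) = γ(z)(μ)`. -/
def centralChar (μ : Module.Dual ℂ H)
    (z : Subalgebra.center ℂ (UniversalEnvelopingAlgebra ℂ 𝔤)) : ℂ :=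
  evalDual μ (harishChandra b z)

/-- The left ideal of `U(𝔤)` generated by `𝔫` and by the elements `h - lam(h)`, `h ∈ 𝔥`. -/
def vermaIdeal (lam : Module.Dual ℂ H) :
    Submodule (UniversalEnvelopingAlgebra ℂ 𝔤) (UniversalEnvelopingAlgebra ℂ 𝔤) :=
  Submodule.span _
    ({w | ∃ y ∈ nPlus b, w = UniversalEnvelopingAlgebra.ι ℂ y} ∪
      {w | ∃ h : H, w = UniversalEnvelopingAlgebra.ι ℂ (h : 𝔤) - algebraMap ℂ _ (lam h)})

/-- The Verma module `U(𝔤) ⊗_{U(𝔟)} ℂ_lam`, presented by its highest weight vector. -/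
abbrev Verma (lam : Module.Dual ℂ H) : Type _ :=
  UniversalEnvelopingAlgebra ℂ 𝔤 ⧸ vermaIdeal b lam

end Triangular

end

/-! The central elements already act as scalars in 𝒜: the extension of π = π_{λ+ρ} to U(𝔤) sends z
to χ_{λ+ρ}(z)·1 in the Weyl algebra (`lift_piHom_center`). Hence z acts by this scalar on every
𝒜-module, in particular on W(λ).

To see this, let 𝒜 act on ℂ[ξ] by x_α ↦ -∂/∂ξ_α, ∂_α ↦ ξ_α (delta functions at the origin of 𝔫̄).
This representation is faithful (`fourierRep_injective`). Through π, the vector 1 becomes a highest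
weight vector of weight λ: passing ∂_α to the left of its coefficient produces -2ρ(h), and λ + ρ + ρ
- 2ρ = λ. Moreover π(f_α) is -ξ_α up to terms that do not raise the degree, so 1 generates ℂ[ξ]
under the π(f_α) (`fourierRep_cyclic`). The action of z on 1 is therefore dictated by the Verma
module, it propagates to ℂ[ξ] because z is central, and faithfulness lifts it to 𝒜.

In the Verma module, z - p(z) lies in 𝔫̄U(𝔤) + U(𝔤)𝔫 and so moves the highest weight vector into
strictly lower eigenspaces of a height element, while z preserves its eigenspace. Hence z acts on
that vector as p(z), that is, by p(z)(λ) = χ_{λ+ρ}(z) (`center_smul_vermaVector`).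

That π is a homomorphism rests on the derivative of the exponential. Write E_a = e^{-ad u}a and let
D_a be the vector field of π(a). Inverting z e^z/(e^z - 1) gives ((1 - e^{-ad u})/ad u)(D_a u) =
-(E_a)_𝔫̄, and `lieDerivation_exp_neg_ad` turns this into D_a E_c = [(E_a)_𝔫̄, E_c]. Since E_{[a,c]}
= [E_a, E_c], 𝔫̄ and 𝔟 are subalgebras and [𝔟, 𝔟] ⊆ 𝔫, the brackets of the vector fields
(`fieldDerivation_lie`) and the cocycle identity of the function parts (`fieldFun_lie`) follow. -/

noncomputable section

/-! ### Weyl algebras: normal ordering and the Fourier representation. -/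

open scoped IsMulCommutative in
/-- The evaluation of polynomials at a family of commuting elements of an algebra. -/
def commAeval {ι A : Type*} [Ring A] [Algebra ℂ A] (y : ι → A)
    (h : ∀ i j, y i * y j = y j * y i) : MvPolynomial ι ℂ →ₐ[ℂ] A :=
  letI : IsMulCommutative (Algebra.adjoin ℂ (Set.range y)) :=
    Algebra.isMulCommutative_adjoin ℂ (by
      rintro _ ⟨i, rfl⟩ _ ⟨j, rfl⟩
      exact h i j)
  (Algebra.adjoin ℂ (Set.range y)).val.comp
    (MvPolynomial.aeval fun i =>
      (⟨y i, Algebra.subset_adjoin ⟨i, rfl⟩⟩ : Algebra.adjoin ℂ (Set.range y)))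

open scoped IsMulCommutative in
theorem commAeval_X {ι A : Type*} [Ring A] [Algebra ℂ A] (y : ι → A)
    (h : ∀ i j, y i * y j = y j * y i) (i : ι) : commAeval y h (MvPolynomial.X i) = y i := by
  simp [commAeval]

theorem commAeval_monomial {ι A : Type*} [Ring A] [Algebra ℂ A] (y : ι → A)
    (h : ∀ i j, y i * y j = y j * y i) (m : ι →₀ ℕ) :
    commAeval y h (MvPolynomial.monomial m 1) =
      m.support.noncommProd (fun i => y i ^ m i)
        (fun i _ j _ _ => Commute.pow_pow (h i j) (m i) (m j)) := by
  have h1 : (MvPolynomial.monomial m 1 : MvPolynomial ι ℂ) =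
      m.support.noncommProd (fun i => MvPolynomial.X i ^ m i) (fun i _ j _ _ =>
        Commute.all (MvPolynomial.X i ^ m i) (MvPolynomial.X j ^ m j)) := by
    rw [MvPolynomial.monomial_eq, Finset.noncommProd_eq_prod]
    simp [Finsupp.prod]
  rw [h1]
  refine (Finset.map_noncommProd _ _ _ (commAeval y h)).trans ?_
  simp only [map_pow, commAeval_X]

namespace WeylAlg

variable {ι : Type*}

/-- `ofPoly` as a homomorphism of algebras. -/
def ofPolyHom : MvPolynomial ι ℂ →ₐ[ℂ] WeylAlg ι := commAeval x x_mul_x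

theorem ofPoly_eq (p : MvPolynomial ι ℂ) : ofPoly p = ofPolyHom p := by
  have : (ofPoly : MvPolynomial ι ℂ →ₗ[ℂ] WeylAlg ι) = ofPolyHom.toLinearMap := by
    refine (MvPolynomial.basisMonomials ι ℂ).ext fun m => ?_
    rw [ofPoly, Module.Basis.constr_basis]
    simp [ofPolyHom, commAeval_monomial, xMonomial]
  rw [this]; rfl

theorem ofPolyHom_X (i : ι) : ofPolyHom (MvPolynomial.X i) = x i := commAeval_X _ _ i

/-- Polynomials in the generators `d i`. -/
def dPolyHom : MvPolynomial ι ℂ →ₐ[ℂ] WeylAlg ι := commAeval d d_mul_d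

theorem dPolyHom_X (i : ι) : dPolyHom (MvPolynomial.X i) = d i := commAeval_X _ _ i

theorem d_mul_x [DecidableEq ι] (i j : ι) :
    (d i * x j : WeylAlg ι) = x j * d i + if i = j then 1 else 0 := by
  split_ifs with h
  · subst h; exact d_mul_x_self i
  · rw [d_mul_x_of_ne h, add_zero]

theorem d_mul_ofPolyHom (i : ι) (p : MvPolynomial ι ℂ) :
    d i * ofPolyHom p = ofPolyHom p * d i + ofPolyHom (MvPolynomial.pderiv i p) := by
  classical
  induction p using MvPolynomial.induction_on with
  | C a =>
    rw [MvPolynomial.pderiv_C, map_zero, add_zero]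
    have : ofPolyHom (MvPolynomial.C a) = algebraMap ℂ (WeylAlg ι) a := ofPolyHom.commutes a
    rw [this, Algebra.commutes]
  | add p q hp hq => simp only [map_add, mul_add, add_mul, hp, hq]; abel
  | mul_X p j hp =>
    rw [map_mul, ofPolyHom_X, ← mul_assoc, hp, add_mul, mul_assoc, d_mul_x,
      Derivation.leibniz, MvPolynomial.pderiv_X, map_add, smul_eq_mul, smul_eq_mul, map_mul,
      map_mul, ofPolyHom_X, mul_add, ← mul_assoc]
    have hc : ofPolyHom (MvPolynomial.pderiv i p) * x j =
        x j * ofPolyHom (MvPolynomial.pderiv i p) := by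
      rw [← ofPolyHom_X, ← map_mul, ← map_mul, mul_comm]
    rw [hc, add_assoc]
    congr 2
    split_ifs with h
    · subst h; simp
    · rw [Pi.single_eq_of_ne' h, map_zero]

theorem x_mul_dPolyHom (i : ι) (p : MvPolynomial ι ℂ) :
    x i * dPolyHom p = dPolyHom p * x i - dPolyHom (MvPolynomial.pderiv i p) := by
  classical
  induction p using MvPolynomial.induction_on with
  | C a =>
    rw [MvPolynomial.pderiv_C, map_zero, sub_zero]
    have : dPolyHom (MvPolynomial.C a) = algebraMap ℂ (WeylAlg ι) a := dPolyHom.commutes a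
    rw [this, Algebra.commutes]
  | add p q hp hq => simp only [map_add, mul_add, add_mul, hp, hq]; abel
  | mul_X p j hp =>
    have hx : (x i * d j : WeylAlg ι) = d j * x i - if i = j then 1 else 0 := by
      rw [d_mul_x]; simp [eq_comm]
    rw [map_mul, dPolyHom_X, ← mul_assoc, hp, sub_mul, mul_assoc, hx,
      Derivation.leibniz, MvPolynomial.pderiv_X, map_add, smul_eq_mul, smul_eq_mul, map_mul,
      map_mul, dPolyHom_X, mul_sub, ← mul_assoc]
    have hc : dPolyHom (MvPolynomial.pderiv i p) * d j =
        d j * dPolyHom (MvPolynomial.pderiv i p) := by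
      rw [← dPolyHom_X, ← map_mul, ← map_mul, mul_comm]
    rw [hc, sub_sub]
    congr 2
    split_ifs with h
    · subst h; simp
    · rw [Pi.single_eq_of_ne' h, map_zero]

theorem adjoin_eq_top :
    Algebra.adjoin ℂ (Set.range (x : ι → WeylAlg ι) ∪ Set.range d) = ⊤ := by
  rw [eq_top_iff]
  intro a _
  obtain ⟨a, rfl⟩ := RingQuot.mkAlgHom_surjective ℂ (WeylRel ι) a
  induction a using FreeAlgebra.induction with
  | grade0 r => rw [AlgHom.commutes]; exact Subalgebra.algebraMap_mem _ r
  | grade1 s =>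
    apply Algebra.subset_adjoin
    rcases s with i | i
    · exact Or.inl ⟨i, rfl⟩
    · exact Or.inr ⟨i, rfl⟩
  | mul a b ha hb => rw [map_mul]; exact mul_mem (ha trivial) (hb trivial)
  | add a b ha hb => rw [map_add]; exact add_mem (ha trivial) (hb trivial)

/-- The elements whose left multiplication preserves P form a subalgebra containing the generators,
so P is a left ideal containing 1. -/
theorem submodule_eq_top (P : Submodule ℂ (WeylAlg ι)) (h1 : 1 ∈ P)
    (hx : ∀ i, ∀ a ∈ P, x i * a ∈ P) (hd : ∀ i, ∀ a ∈ P, d i * a ∈ P) : P = ⊤ := by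
  let S : Subalgebra ℂ (WeylAlg ι) :=
    { carrier := {a | ∀ s ∈ P, a * s ∈ P}
      mul_mem' := fun {a b} ha hb s hs => by rw [mul_assoc]; exact ha _ (hb s hs)
      add_mem' := fun {a b} ha hb s hs => by rw [add_mul]; exact add_mem (ha s hs) (hb s hs)
      algebraMap_mem' := fun r s hs => by
        rw [← Algebra.smul_def]; exact P.smul_mem r hs }
  have hS : S = ⊤ := by
    rw [eq_top_iff, ← adjoin_eq_top, Algebra.adjoin_le_iff]
    rintro a (⟨i, rfl⟩ | ⟨i, rfl⟩)
    · exact hx i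
    · exact hd i
  rw [eq_top_iff]
  intro a _
  have : a ∈ S := hS ▸ trivial
  simpa using this 1 h1

/-- The representation of the Weyl algebra on polynomials in which `x i` acts by `-∂/∂ξ i` and `d i`
by multiplication with `ξ i`. -/
def fourierRep : WeylAlg ι →ₐ[ℂ] Module.End ℂ (MvPolynomial ι ℂ) :=
  RingQuot.liftAlgHom ℂ ⟨FreeAlgebra.lift ℂ (Sum.elim
    (fun i => -(MvPolynomial.pderiv i).toLinearMap)
    (fun i => LinearMap.mulLeft ℂ (MvPolynomial.X i))), by
  classical
  intro a b hab
  induction hab with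
  | x_comm i j =>
    simp only [map_mul, FreeAlgebra.lift_ι_apply, Sum.elim_inl]
    refine LinearMap.ext fun p => MvPolynomial.induction_on' p ?_ ?_
    · intro n c
      simp only [Module.End.mul_apply, LinearMap.neg_apply, map_neg, neg_neg, Derivation.coeFn_coe,
        MvPolynomial.pderiv_monomial]
      by_cases h : i = j
      · subst h; rfl
      · rw [tsub_right_comm]
        congr 1
        simp [h, Ne.symm h]
        ring
    · intro p q hp hq
      rw [map_add, map_add, hp, hq]
  | d_comm i j =>
    refine LinearMap.ext fun p => ?_
    simp [mul_left_comm]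
  | d_x_self i =>
    refine LinearMap.ext fun p => ?_
    simp
  | d_x_ne i j hij =>
    refine LinearMap.ext fun p => ?_
    simp [MvPolynomial.pderiv_X_of_ne hij]⟩

theorem fourierRep_x (i : ι) (p : MvPolynomial ι ℂ) :
    fourierRep (x i) p = -MvPolynomial.pderiv i p := by
  have h : fourierRep (x i) = FreeAlgebra.lift ℂ (Sum.elim
      (fun i => -(MvPolynomial.pderiv i).toLinearMap)
      (fun i => LinearMap.mulLeft ℂ (MvPolynomial.X i))) (FreeAlgebra.ι ℂ (Sum.inl i)) :=
    RingQuot.liftAlgHom_mkAlgHom_apply ..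
  rw [h]; simp

theorem fourierRep_d (i : ι) (p : MvPolynomial ι ℂ) :
    fourierRep (d i) p = MvPolynomial.X i * p := by
  have h : fourierRep (d i) = FreeAlgebra.lift ℂ (Sum.elim
      (fun i => -(MvPolynomial.pderiv i).toLinearMap)
      (fun i => LinearMap.mulLeft ℂ (MvPolynomial.X i))) (FreeAlgebra.ι ℂ (Sum.inr i)) :=
    RingQuot.liftAlgHom_mkAlgHom_apply ..
  rw [h]; simp

theorem fourierRep_dPolyHom (p q : MvPolynomial ι ℂ) : fourierRep (dPolyHom p) q = p * q := by
  induction p using MvPolynomial.induction_on generalizing q with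
  | C a =>
    have : dPolyHom (MvPolynomial.C a) = algebraMap ℂ (WeylAlg ι) a := dPolyHom.commutes a
    rw [this, AlgHom.commutes, Module.algebraMap_end_apply, MvPolynomial.smul_eq_C_mul]
  | add p r hp hr => rw [map_add, map_add, LinearMap.add_apply, hp, hr, add_mul]
  | mul_X p j hp => rw [map_mul, map_mul, Module.End.mul_apply, hp, dPolyHom_X, fourierRep_d, mul_assoc]

/-- Up to sign this is the m-th derivative of ξ^n. When m ≤ n fails the constant is 0, so the
truncated exponent n - m is harmless. -/
theorem fourierRep_monomial (m n : ι →₀ ℕ) : ∃ c : ℂ, (c ≠ 0 ↔ m ≤ n) ∧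
    fourierRep (ofPolyHom (MvPolynomial.monomial m 1)) (MvPolynomial.monomial n 1) =
      MvPolynomial.monomial (n - m) c := by
  classical
  have hadd : ∀ f g : ι →₀ ℕ,
      (∀ n : ι →₀ ℕ, ∃ c : ℂ, (c ≠ 0 ↔ f ≤ n) ∧
        fourierRep (ofPolyHom (MvPolynomial.monomial f 1)) (MvPolynomial.monomial n 1) =
          MvPolynomial.monomial (n - f) c) →
      (∀ n : ι →₀ ℕ, ∃ c : ℂ, (c ≠ 0 ↔ g ≤ n) ∧
        fourierRep (ofPolyHom (MvPolynomial.monomial g 1)) (MvPolynomial.monomial n 1) =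
          MvPolynomial.monomial (n - g) c) →
      (∀ n : ι →₀ ℕ, ∃ c : ℂ, (c ≠ 0 ↔ f + g ≤ n) ∧
        fourierRep (ofPolyHom (MvPolynomial.monomial (f + g) 1)) (MvPolynomial.monomial n 1) =
          MvPolynomial.monomial (n - (f + g)) c) := by
    intro f g hf hg n
    obtain ⟨c, hc, h1⟩ := hg n
    obtain ⟨c', hc', h2⟩ := hf (n - g)
    have hm : (MvPolynomial.monomial (f + g) 1 : MvPolynomial ι ℂ) =
        MvPolynomial.monomial f 1 * MvPolynomial.monomial g 1 := by
      rw [MvPolynomial.monomial_mul, one_mul]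
    have hs : (MvPolynomial.monomial (n - g) c : MvPolynomial ι ℂ) =
        c • MvPolynomial.monomial (n - g) 1 := by
      rw [MvPolynomial.smul_monomial, smul_eq_mul, mul_one]
    refine ⟨c * c', ?_, ?_⟩
    · rw [mul_ne_zero_iff, hc, hc']
      constructor
      · rintro ⟨h3, h4⟩
        exact (add_le_add_left h4 g).trans (by rw [tsub_add_cancel_of_le h3])
      · intro h
        have h3 : g ≤ n := le_trans (le_add_of_nonneg_left (zero_le)) h
        exact ⟨h3, (le_tsub_iff_right h3).mpr h⟩
    · rw [hm, map_mul, map_mul, Module.End.mul_apply, h1, hs, map_smul, h2,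
        MvPolynomial.smul_monomial, smul_eq_mul, tsub_tsub, add_comm g f]
  induction m using Finsupp.induction_linear generalizing n with
  | zero => exact ⟨1, by simp, by simp⟩
  | add f g hf hg => exact hadd f g hf hg n
  | single i k =>
    induction k generalizing n with
    | zero => exact ⟨1, by simp, by simp⟩
    | succ k ih =>
      rw [Finsupp.single_add]
      refine hadd _ _ (fun n => ih n) (fun n => ?_) n
      -- A single derivative -∂/∂ξ_i produces the factor -n_i, which vanishes exactly when ξ_i does
      -- not occur.
      refine ⟨-(n i : ℂ), ?_, ?_⟩
      · rw [neg_ne_zero, Nat.cast_ne_zero, Finsupp.single_le_iff, Nat.one_le_iff_ne_zero]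
      · change fourierRep (ofPolyHom (MvPolynomial.X i)) _ = _
        rw [ofPolyHom_X, fourierRep_x, MvPolynomial.pderiv_monomial, one_mul, ← map_neg]

/-- The linear combinations of the normally ordered monomials. -/
def normalForm : ((ι →₀ ℕ) →₀ MvPolynomial ι ℂ) →ₗ[ℂ] WeylAlg ι :=
  Finsupp.lsum ℂ fun m =>
    LinearMap.mulRight ℂ (ofPolyHom (MvPolynomial.monomial m 1)) ∘ₗ dPolyHom.toLinearMap

theorem normalForm_single (m : ι →₀ ℕ) (p : MvPolynomial ι ℂ) :
    normalForm (Finsupp.single m p) = dPolyHom p * ofPolyHom (MvPolynomial.monomial m 1) := by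
  simp [normalForm]

theorem normalForm_surjective : Function.Surjective (normalForm (ι := ι)) := by
  rw [← LinearMap.range_eq_top]
  apply submodule_eq_top
  · exact ⟨Finsupp.single 0 1, by rw [normalForm_single]; simp⟩
  · rintro i _ ⟨c, rfl⟩
    induction c using Finsupp.induction_linear with
    | zero => rw [map_zero, mul_zero]; exact zero_mem _
    | add f g hf hg => rw [map_add, mul_add]; exact add_mem hf hg
    | single m p =>
      rw [normalForm_single, ← mul_assoc, x_mul_dPolyHom, sub_mul, mul_assoc, ← ofPolyHom_X,
        ← map_mul, MvPolynomial.X, MvPolynomial.monomial_mul, one_mul, ← normalForm_single,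
        ← normalForm_single]
      exact sub_mem ⟨_, rfl⟩ ⟨_, rfl⟩
  · rintro i _ ⟨c, rfl⟩
    induction c using Finsupp.induction_linear with
    | zero => rw [map_zero, mul_zero]; exact zero_mem _
    | add f g hf hg => rw [map_add, mul_add]; exact add_mem hf hg
    | single m p =>
      rw [normalForm_single, ← mul_assoc, ← dPolyHom_X, ← map_mul, ← normalForm_single]
      exact ⟨_, rfl⟩

/-- Write a nonzero element as ∑ p_m(∂) x^m and apply it to ξ^n, with n of least degree among the
exponents that occur. Another term could survive only if m ≤ n, and minimality then forces m = n.
What is left is a nonzero multiple of p_n. -/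
theorem fourierRep_injective : Function.Injective (fourierRep (ι := ι)) := by
  rw [injective_iff_map_eq_zero]
  intro w hw
  obtain ⟨c, rfl⟩ := normalForm_surjective w
  by_contra hne
  have hc : c.support.Nonempty := by
    rw [Finset.nonempty_iff_ne_empty]
    intro h
    rw [Finsupp.support_eq_empty] at h
    exact hne (by rw [h, map_zero])
  obtain ⟨n, hn, hmin⟩ := Finset.exists_min_image c.support Finsupp.degree hc
  have h1 : fourierRep (normalForm c) (MvPolynomial.monomial n 1) = 0 := by rw [hw]; rfl
  have h2 : normalForm c = ∑ m ∈ c.support,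
      dPolyHom (c m) * ofPolyHom (MvPolynomial.monomial m 1) := by
    simp [normalForm, Finsupp.sum]
  rw [h2, map_sum, LinearMap.sum_apply, Finset.sum_eq_single n] at h1
  · obtain ⟨a, ha, h3⟩ := fourierRep_monomial n n
    rw [map_mul, Module.End.mul_apply, h3, fourierRep_dPolyHom, tsub_self] at h1
    rcases mul_eq_zero.mp h1 with h | h
    · exact Finsupp.mem_support_iff.mp hn h
    · rw [MvPolynomial.monomial_eq_zero] at h
      exact ha.mpr le_rfl h
  · intro m hm hmn
    obtain ⟨a, ha, h3⟩ := fourierRep_monomial m n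
    have : a = 0 := by
      by_contra h0
      have hle := ha.mp h0
      apply hmn
      have h4 : n = (n - m) + m := (tsub_add_cancel_of_le hle).symm
      have h5 := hmin m hm
      rw [h4, map_add] at h5
      have h6 : Finsupp.degree (n - m) = 0 := by omega
      rw [Finsupp.degree_eq_zero_iff] at h6
      rw [h4, h6, zero_add]
    rw [map_mul, Module.End.mul_apply, h3, this, map_zero, map_zero]
  · exact fun h => (h hn).elim

/-- A polynomial in the x i acts as a differential operator with constant coefficients: its constant
term reproduces ξ^n and every other term lowers the degree. -/
theorem fourierRep_ofPolyHom_mem (q : MvPolynomial ι ℂ) (n : ι →₀ ℕ)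
    (S : Submodule ℂ (MvPolynomial ι ℂ))
    (hS : ∀ n' : ι →₀ ℕ, n'.degree < n.degree → MvPolynomial.monomial n' 1 ∈ S)
    (h : MvPolynomial.constantCoeff q = 0 ∨ MvPolynomial.monomial n 1 ∈ S) :
    fourierRep (ofPolyHom q) (MvPolynomial.monomial n 1) ∈ S := by
  rw [q.as_sum, map_sum, map_sum, LinearMap.sum_apply]
  refine sum_mem fun m hm => ?_
  have hs : (MvPolynomial.monomial m (q.coeff m) : MvPolynomial ι ℂ) =
      q.coeff m • MvPolynomial.monomial m 1 := by
    rw [MvPolynomial.smul_monomial, smul_eq_mul, mul_one]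
  rw [hs, map_smul, map_smul, LinearMap.smul_apply]
  refine S.smul_mem _ ?_
  obtain ⟨a, ha, h3⟩ := fourierRep_monomial m n
  have hs' : (MvPolynomial.monomial (n - m) a : MvPolynomial ι ℂ) =
      a • MvPolynomial.monomial (n - m) 1 := by
    rw [MvPolynomial.smul_monomial, smul_eq_mul, mul_one]
  rw [h3, hs']
  by_cases h0 : a = 0
  · rw [h0, zero_smul]; exact zero_mem _
  refine S.smul_mem _ ?_
  have hle := ha.mp h0
  by_cases hm0 : m = 0
  · subst hm0
    rcases h with h | h
    · exact absurd h (MvPolynomial.mem_support_iff.mp hm)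
    · rwa [tsub_zero]
  · apply hS
    have h4 : n = (n - m) + m := (tsub_add_cancel_of_le hle).symm
    have h5 : n.degree = (n - m).degree + m.degree := by rw [← map_add, ← h4]
    have h6 : m.degree ≠ 0 := fun h => hm0 (by rwa [Finsupp.degree_eq_zero_iff] at h)
    omega

/-- On ξ^n the operator is -ξ_i ξ^n plus terms of degree at most that of ξ^n, because a p i j
without constant term loses at least the degree that d j gains. Induction on the degree puts every
monomial into S. -/
theorem fourierRep_cyclic [Fintype ι] (p : ι → ι → MvPolynomial ι ℂ) (q : ι → MvPolynomial ι ℂ)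
    (hp : ∀ i j, MvPolynomial.constantCoeff (p i j) = 0) (S : Submodule ℂ (MvPolynomial ι ℂ))
    (h1 : 1 ∈ S)
    (hS : ∀ i, ∀ v ∈ S, fourierRep (-d i + ∑ j, ofPolyHom (p i j) * d j + ofPolyHom (q i)) v ∈ S) :
    S = ⊤ := by
  have key : ∀ k : ℕ, ∀ n : ι →₀ ℕ, n.degree = k → MvPolynomial.monomial n 1 ∈ S := by
    intro k
    induction k using Nat.strong_induction_on with
    | _ k ih =>
    intro n hn
    by_cases h0 : n = 0
    · subst h0; exact h1
    obtain ⟨i, hi⟩ := Finsupp.ne_iff.mp h0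
    have hle : Finsupp.single i 1 ≤ n := by
      rw [Finsupp.single_le_iff]; exact Nat.one_le_iff_ne_zero.mpr hi
    obtain ⟨n', rfl⟩ := exists_add_of_le hle
    have hmul : ∀ j, fourierRep (d j) (MvPolynomial.monomial n' 1) =
        MvPolynomial.monomial (Finsupp.single j 1 + n') 1 := by
      intro j
      rw [fourierRep_d, MvPolynomial.X, MvPolynomial.monomial_mul, one_mul]
    have hdeg : ∀ j, (Finsupp.single j 1 + n').degree = n'.degree + 1 := by
      intro j; rw [map_add, Finsupp.degree_single, add_comm]
    rw [hdeg] at hn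
    have hlow : ∀ n'' : ι →₀ ℕ, n''.degree < n'.degree + 1 → MvPolynomial.monomial n'' 1 ∈ S :=
      fun n'' h => ih _ (hn ▸ h) n'' rfl
    have hn' := hlow n' (Nat.lt_succ_self _)
    have h2 := hS i _ hn'
    rw [map_add, map_add, map_neg, map_sum, LinearMap.add_apply, LinearMap.add_apply,
      LinearMap.neg_apply, LinearMap.sum_apply, hmul] at h2
    have h3 : ∑ j, fourierRep (ofPolyHom (p i j) * d j) (MvPolynomial.monomial n' 1) ∈ S := by
      refine sum_mem fun j _ => ?_
      rw [map_mul, Module.End.mul_apply, hmul]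
      exact fourierRep_ofPolyHom_mem _ _ S (fun n'' h => hlow n'' (by rwa [hdeg] at h))
        (Or.inl (hp i j))
    have h4 := fourierRep_ofPolyHom_mem (q i) n' S
      (fun n'' h => hlow n'' (h.trans (Nat.lt_succ_self _))) (Or.inr hn')
    have h5 := sub_mem h2 (add_mem h3 h4)
    rw [add_assoc, add_sub_cancel_right] at h5
    exact neg_mem_iff.mp h5
  rw [eq_top_iff, ← (MvPolynomial.basisMonomials ι ℂ).span_eq, Submodule.span_le]
  rintro _ ⟨n, rfl⟩
  simpa using key _ n rfl

end WeylAlg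

/-! ### Power series in a nilpotent operator. -/

section EvalNilpotent

variable {R M : Type*} [CommRing R] [Algebra ℂ R] [AddCommGroup M] [Module R M]

/-- Any exponent that kills T may serve as cutoff, so that operators of different nilpotency classes
can be compared over a common range. -/
theorem evalNilpotent_eq_sum (F : PowerSeries ℂ) {T : Module.End R M} {N : ℕ} (hT : T ^ N = 0) :
    evalNilpotent F T =
      ∑ n ∈ Finset.range N, algebraMap ℂ R (PowerSeries.coeff n F) • T ^ n := by
  rw [evalNilpotent]
  refine Finset.sum_subset (Finset.range_mono (csInf_le' hT)) fun n _ hn => ?_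
  rw [Finset.mem_range, not_lt] at hn
  rw [pow_eq_zero_of_le hn (pow_nilpotencyClass ⟨N, hT⟩), smul_zero]

theorem evalNilpotent_apply (F : PowerSeries ℂ) {T : Module.End R M} {N : ℕ} (hT : T ^ N = 0)
    (v : M) : evalNilpotent F T v =
      ∑ n ∈ Finset.range N, algebraMap ℂ R (PowerSeries.coeff n F) • (T ^ n) v := by
  rw [evalNilpotent_eq_sum F hT, LinearMap.sum_apply]
  rfl

theorem evalNilpotent_eq_aeval (F : PowerSeries ℂ) {T : Module.End R M} {N : ℕ} (hT : T ^ N = 0) :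
    evalNilpotent F T =
      Polynomial.aeval T ((PowerSeries.trunc N F).map (algebraMap ℂ R)) := by
  rw [evalNilpotent_eq_sum F hT, Polynomial.aeval_def, Polynomial.eval₂_map,
    PowerSeries.eval₂_trunc_eq_sum_range]
  refine Finset.sum_congr rfl fun n _ => ?_
  rw [Algebra.smul_def]; rfl

/-- The truncation of F * G and the product of the truncations differ by a multiple of X ^ N, which
T annihilates. -/
theorem evalNilpotent_mul (F G : PowerSeries ℂ) {T : Module.End R M} (hT : IsNilpotent T) :
    evalNilpotent (F * G) T = evalNilpotent F T * evalNilpotent G T := by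
  obtain ⟨N, hN⟩ := hT
  rw [evalNilpotent_eq_aeval _ hN, evalNilpotent_eq_aeval _ hN, evalNilpotent_eq_aeval _ hN,
    ← map_mul, ← Polynomial.map_mul, ← sub_eq_zero, ← map_sub, ← Polynomial.map_sub]
  have h : Polynomial.X ^ N ∣ PowerSeries.trunc N (F * G) -
      PowerSeries.trunc N F * PowerSeries.trunc N G := by
    rw [Polynomial.X_pow_dvd_iff]
    intro d hd
    rw [Polynomial.coeff_sub, PowerSeries.coeff_trunc, if_pos hd, ← Polynomial.coeff_coe,
      Polynomial.coe_mul, PowerSeries.coeff_mul_eq_coeff_trunc_mul_trunc F G hd, sub_self]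
  obtain ⟨Q, hQ⟩ := h
  rw [hQ, Polynomial.map_mul, map_mul, Polynomial.map_pow, Polynomial.map_X, map_pow,
    Polynomial.aeval_X, hN, zero_mul]

theorem evalNilpotent_one {T : Module.End R M} (hT : IsNilpotent T) :
    evalNilpotent 1 T = 1 := by
  obtain ⟨N, hN⟩ := hT
  have hN' : T ^ (N + 1) = 0 := pow_eq_zero_of_le (Nat.le_succ N) hN
  rw [evalNilpotent_eq_sum _ hN', Finset.sum_range_succ', Finset.sum_eq_zero]
  · simp
  · intro n _
    rw [PowerSeries.coeff_one, if_neg (Nat.succ_ne_zero n), map_zero, zero_smul]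

theorem evalNilpotent_sub (F G : PowerSeries ℂ) (T : Module.End R M) :
    evalNilpotent (F - G) T = evalNilpotent F T - evalNilpotent G T := by
  simp only [evalNilpotent, map_sub, sub_smul, Finset.sum_sub_distrib]

theorem evalNilpotent_X {T : Module.End R M} (hT : IsNilpotent T) :
    evalNilpotent PowerSeries.X T = T := by
  obtain ⟨N, hN⟩ := hT
  have hN' : T ^ (N + 2) = 0 := pow_eq_zero_of_le (by omega) hN
  rw [evalNilpotent_eq_sum _ hN', Finset.sum_eq_single 1]
  · simp
  · intro n _ hn
    rw [PowerSeries.coeff_X, if_neg hn, map_zero, zero_smul]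
  · simp

theorem evalNilpotent_evalNegHom (F : PowerSeries ℂ) {T : Module.End R M} (hT : IsNilpotent T) :
    evalNilpotent (PowerSeries.evalNegHom F) T = evalNilpotent F (-T) := by
  obtain ⟨N, hN⟩ := hT
  have hN' : (-T) ^ N = 0 := by rw [neg_pow, hN, mul_zero]
  rw [evalNilpotent_eq_sum _ hN, evalNilpotent_eq_sum _ hN']
  refine Finset.sum_congr rfl fun n _ => ?_
  rw [PowerSeries.evalNegHom, PowerSeries.coeff_rescale, neg_pow T, map_mul, mul_smul, map_pow,
    map_neg, map_one, smul_comm]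
  rcases neg_one_pow_eq_or (Module.End R M) n with h | h <;>
  rcases Nat.even_or_odd n with h' | h' <;> simp [h'.neg_one_pow]

theorem map_evalNilpotent {M' : Type*} [AddCommGroup M'] [Module R M'] (F : PowerSeries ℂ)
    {T : Module.End R M} {T' : Module.End R M'} (hT : IsNilpotent T) (hT' : IsNilpotent T')
    (g : M →ₗ[R] M') (h : ∀ v, g (T v) = T' (g v)) (v : M) :
    g (evalNilpotent F T v) = evalNilpotent F T' (g v) := by
  obtain ⟨N, hN⟩ := hT
  obtain ⟨N', hN'⟩ := hT'
  have h1 : T ^ max N N' = 0 := pow_eq_zero_of_le (le_max_left _ _) hN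
  have h2 : T' ^ max N N' = 0 := pow_eq_zero_of_le (le_max_right _ _) hN'
  have h3 : ∀ n v, g ((T ^ n) v) = (T' ^ n) (g v) := by
    intro n
    induction n with
    | zero => intro v; rfl
    | succ n ih => intro v; rw [pow_succ, pow_succ, Module.End.mul_apply, ih, h]; rfl
  rw [evalNilpotent_apply F h1, evalNilpotent_apply F h2, map_sum]
  simp only [map_smul, h3]

/-- The operator ad u(x) is ℂ[x]-linear, but derivations of the coefficients are only ℂ-linear; this
permits the passage to ℂ-linear operators. -/
theorem evalNilpotent_restrictScalars [Module ℂ M] [IsScalarTower ℂ R M] (F : PowerSeries ℂ)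
    {T : Module.End R M} (hT : IsNilpotent T) {T' : Module.End ℂ M} (h : ∀ v, T v = T' v) (v : M) :
    evalNilpotent F T v = evalNilpotent F T' v := by
  obtain ⟨N, hN⟩ := hT
  have h3 : ∀ n v, (T ^ n) v = (T' ^ n) v := by
    intro n
    induction n with
    | zero => intro v; rfl
    | succ n ih => intro v; rw [pow_succ, pow_succ, Module.End.mul_apply, ih, h]; rfl
  have hN' : T' ^ N = 0 := by ext v; rw [← h3, hN]; rfl
  rw [evalNilpotent_apply F hN, evalNilpotent_apply F hN']
  simp only [algebraMap_smul, h3, Algebra.algebraMap_self, RingHom.id_apply]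

end EvalNilpotent

theorem evalNilpotent_exp_eq {M : Type*} [AddCommGroup M] [Module ℂ M]
    [Module ℚ (Module.End ℂ M)] (T : Module.End ℂ M) :
    evalNilpotent (PowerSeries.exp ℂ) T = IsNilpotent.exp T := by
  rw [evalNilpotent, IsNilpotent.exp]
  refine Finset.sum_congr rfl fun n _ => ?_
  rw [PowerSeries.coeff_exp, ← Rat.cast_smul_eq_qsmul ℂ]
  simp

/-- The power series `(1 - e^{-z}) / z`. -/
def maurerCartanSeries : PowerSeries ℂ := (bernoulli'PowerSeries ℂ)⁻¹

theorem bernoulli'_mul_maurerCartan :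
    bernoulli'PowerSeries ℂ * maurerCartanSeries = 1 := by
  apply PowerSeries.mul_inv_cancel
  rw [← PowerSeries.coeff_zero_eq_constantCoeff_apply]
  simp [bernoulli'PowerSeries]

theorem maurerCartan_mul_X :
    maurerCartanSeries * PowerSeries.X =
      1 - PowerSeries.evalNegHom (PowerSeries.exp ℂ) := by
  have h1 := bernoulli'PowerSeries_mul_exp_sub_one ℂ
  have h2 := bernoulli'_mul_maurerCartan
  have h3 := PowerSeries.exp_mul_exp_neg_eq_one (A := ℂ)
  linear_combination (-PowerSeries.evalNegHom (PowerSeries.exp ℂ) * maurerCartanSeries) * h1 +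
    PowerSeries.evalNegHom (PowerSeries.exp ℂ) * (PowerSeries.exp ℂ - 1) * h2 +
    (1 - maurerCartanSeries * PowerSeries.X) * h3

/-! ### Conjugation by exponentials and the derivative of e^{-ad u}. -/

section Conjugation

variable {M : Type*} [AddCommGroup M] [Module ℂ M]

theorem evalNilpotent_exp_neg_mul {T : Module.End ℂ M} (hT : IsNilpotent T) :
    evalNilpotent (PowerSeries.exp ℂ) T * evalNilpotent (PowerSeries.exp ℂ) (-T) = 1 := by
  rw [← evalNilpotent_evalNegHom _ hT, ← evalNilpotent_mul _ _ hT,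
    PowerSeries.exp_mul_exp_neg_eq_one, evalNilpotent_one hT]

/-- The operator `S ↦ T S - S T`. -/
def commutatorOp (T : Module.End ℂ M) : Module.End ℂ (Module.End ℂ M) :=
  LinearMap.mulLeft ℂ T - LinearMap.mulRight ℂ T

theorem isNilpotent_mulLeft {T : Module.End ℂ M} (hT : IsNilpotent T) :
    IsNilpotent (LinearMap.mulLeft ℂ T) := by
  obtain ⟨N, hN⟩ := hT
  exact ⟨N, by rw [LinearMap.pow_mulLeft, hN, LinearMap.mulLeft_zero_eq_zero]⟩

theorem isNilpotent_mulRight {T : Module.End ℂ M} (hT : IsNilpotent T) :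
    IsNilpotent (LinearMap.mulRight ℂ T) := by
  obtain ⟨N, hN⟩ := hT
  exact ⟨N, by rw [LinearMap.pow_mulRight, hN, LinearMap.mulRight_zero_eq_zero]⟩

theorem isNilpotent_commutatorOp {T : Module.End ℂ M} (hT : IsNilpotent T) :
    IsNilpotent (commutatorOp T) :=
  (LinearMap.commute_mulLeft_right T T).isNilpotent_sub
    (isNilpotent_mulLeft hT) (isNilpotent_mulRight hT)

theorem evalNilpotent_mulLeft (F : PowerSeries ℂ) {T : Module.End ℂ M} (hT : IsNilpotent T) :
    evalNilpotent F (LinearMap.mulLeft ℂ T) = LinearMap.mulLeft ℂ (evalNilpotent F T) := by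
  obtain ⟨N, hN⟩ := hT
  have h1 : LinearMap.mulLeft ℂ T ^ N = 0 := by
    rw [LinearMap.pow_mulLeft, hN, LinearMap.mulLeft_zero_eq_zero]
  refine LinearMap.ext fun S => ?_
  rw [evalNilpotent_apply F h1, evalNilpotent_eq_sum F hN, LinearMap.mulLeft_apply, Finset.sum_mul]
  simp only [LinearMap.pow_mulLeft, LinearMap.mulLeft_apply, smul_mul_assoc]

theorem evalNilpotent_mulRight (F : PowerSeries ℂ) {T : Module.End ℂ M} (hT : IsNilpotent T) :
    evalNilpotent F (LinearMap.mulRight ℂ T) = LinearMap.mulRight ℂ (evalNilpotent F T) := by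
  obtain ⟨N, hN⟩ := hT
  have h1 : LinearMap.mulRight ℂ T ^ N = 0 := by
    rw [LinearMap.pow_mulRight, hN, LinearMap.mulRight_zero_eq_zero]
  refine LinearMap.ext fun S => ?_
  rw [evalNilpotent_apply F h1, evalNilpotent_eq_sum F hN, LinearMap.mulRight_apply,
    Finset.mul_sum]
  simp only [LinearMap.pow_mulRight, LinearMap.mulRight_apply, mul_smul_comm]

/-- Left and right multiplication by T commute and are nilpotent, so the exponential of their
difference splits into a product. -/
theorem evalNilpotent_exp_neg_commutatorOp {T : Module.End ℂ M} (hT : IsNilpotent T)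
    (S : Module.End ℂ M) :
    evalNilpotent (PowerSeries.exp ℂ) (-commutatorOp T) S =
      evalNilpotent (PowerSeries.exp ℂ) (-T) * S * evalNilpotent (PowerSeries.exp ℂ) T := by
  let _ : Module ℚ (Module.End ℂ (Module.End ℂ M)) := Module.compHom _ (algebraMap ℚ ℂ)
  have h1 : -commutatorOp T = LinearMap.mulLeft ℂ (-T) + LinearMap.mulRight ℂ T := by
    refine LinearMap.ext fun S => ?_
    simp [commutatorOp, sub_eq_add_neg, add_comm]
  rw [h1, evalNilpotent_exp_eq, IsNilpotent.exp_add_of_commute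
    (LinearMap.commute_mulLeft_right (-T) T) (isNilpotent_mulLeft hT.neg)
    (isNilpotent_mulRight hT), ← evalNilpotent_exp_eq, ← evalNilpotent_exp_eq,
    evalNilpotent_mulLeft _ hT.neg, evalNilpotent_mulRight _ hT]
  simp [mul_assoc]

/-- This is the identity ((1 - e^{-z})/z)·z = 1 - e^{-z} at z = `commutatorOp T`, applied to S. -/
theorem evalNilpotent_maurerCartan_commutatorOp {T : Module.End ℂ M} (hT : IsNilpotent T)
    (S : Module.End ℂ M) :
    evalNilpotent maurerCartanSeries (commutatorOp T) (T * S - S * T) =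
      S - evalNilpotent (PowerSeries.exp ℂ) (-T) * S * evalNilpotent (PowerSeries.exp ℂ) T := by
  have hZ := isNilpotent_commutatorOp hT
  have h := evalNilpotent_mul maurerCartanSeries PowerSeries.X hZ
  rw [maurerCartan_mul_X, evalNilpotent_sub, evalNilpotent_one hZ, evalNilpotent_X hZ,
    evalNilpotent_evalNegHom _ hZ] at h
  have h2 := LinearMap.congr_fun h S
  rw [LinearMap.sub_apply, evalNilpotent_exp_neg_commutatorOp hT] at h2
  exact h2.symm

end Conjugation

section LieExp

variable {L : Type*} [LieRing L] [LieAlgebra ℂ L]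

theorem commutatorOp_ad (u v : L) :
    LieAlgebra.ad ℂ L (LieAlgebra.ad ℂ L u v) =
      commutatorOp (LieAlgebra.ad ℂ L u) (LieAlgebra.ad ℂ L v) := by
  rw [LieAlgebra.ad_apply, LieHom.map_lie]; rfl

theorem ad_evalNilpotent_ad (F : PowerSeries ℂ) {u : L}
    (hu : IsNilpotent (LieAlgebra.ad ℂ L u)) (v : L) :
    LieAlgebra.ad ℂ L (evalNilpotent F (LieAlgebra.ad ℂ L u) v) =
      evalNilpotent F (commutatorOp (LieAlgebra.ad ℂ L u)) (LieAlgebra.ad ℂ L v) :=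
  map_evalNilpotent F hu (isNilpotent_commutatorOp hu) (LieAlgebra.ad ℂ L).toLinearMap
    (fun w => commutatorOp_ad u w) v

/-- Because ad(e^{-ad u} v) = e^{-ad u} (ad v) e^{ad u}. -/
theorem evalNilpotent_exp_neg_lie {u : L} (hu : IsNilpotent (LieAlgebra.ad ℂ L u)) (v w : L) :
    evalNilpotent (PowerSeries.exp ℂ) (-LieAlgebra.ad ℂ L u) ⁅v, w⁆ =
      ⁅evalNilpotent (PowerSeries.exp ℂ) (-LieAlgebra.ad ℂ L u) v,
        evalNilpotent (PowerSeries.exp ℂ) (-LieAlgebra.ad ℂ L u) w⁆ := by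
  have hn : -LieAlgebra.ad ℂ L u = LieAlgebra.ad ℂ L (-u) := (map_neg _ _).symm
  have hc : commutatorOp (-LieAlgebra.ad ℂ L u) = -commutatorOp (LieAlgebra.ad ℂ L u) := by
    refine LinearMap.ext fun S => ?_
    simp [commutatorOp, sub_eq_add_neg, add_comm]
  have h1 := ad_evalNilpotent_ad (PowerSeries.exp ℂ) (u := -u) (hn ▸ hu.neg) v
  rw [← hn, hc, evalNilpotent_exp_neg_commutatorOp hu] at h1
  have h2 := LinearMap.congr_fun h1 (evalNilpotent (PowerSeries.exp ℂ) (-LieAlgebra.ad ℂ L u) w)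
  rw [LieAlgebra.ad_apply, Module.End.mul_apply, ← Module.End.mul_apply (evalNilpotent _ _)
    (evalNilpotent _ (-_)) w, evalNilpotent_exp_neg_mul hu] at h2
  exact h2.symm

/-- The commutator of ad u with D is -ad(D u), so the conjugation formula with S = D computes D -
e^{-ad u} D e^{ad u}; it is then applied to e^{-ad u} c. -/
theorem lieDerivation_exp_neg_ad (D : LieDerivation ℂ L L) {u : L}
    (hu : IsNilpotent (LieAlgebra.ad ℂ L u)) (c : L) :
    D (evalNilpotent (PowerSeries.exp ℂ) (-LieAlgebra.ad ℂ L u) c) =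
      evalNilpotent (PowerSeries.exp ℂ) (-LieAlgebra.ad ℂ L u) (D c) -
        ⁅evalNilpotent maurerCartanSeries (LieAlgebra.ad ℂ L u) (D u),
          evalNilpotent (PowerSeries.exp ℂ) (-LieAlgebra.ad ℂ L u) c⁆ := by
  have h1 : LieAlgebra.ad ℂ L u * D.toLinearMap - D.toLinearMap * LieAlgebra.ad ℂ L u =
      -LieAlgebra.ad ℂ L (D u) := by
    refine LinearMap.ext fun v => ?_
    have := D.apply_lie_eq_add u v
    change ⁅u, D v⁆ - D ⁅u, v⁆ = -⁅D u, v⁆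
    rw [this]; abel
  have h2 := evalNilpotent_maurerCartan_commutatorOp hu D.toLinearMap
  rw [h1, map_neg, ← ad_evalNilpotent_ad _ hu] at h2
  have h3 := LinearMap.congr_fun h2 (evalNilpotent (PowerSeries.exp ℂ) (-LieAlgebra.ad ℂ L u) c)
  rw [LinearMap.neg_apply, LinearMap.sub_apply, Module.End.mul_apply,
    ← Module.End.mul_apply (evalNilpotent _ (LieAlgebra.ad ℂ L u)), evalNilpotent_exp_neg_mul hu,
    LieAlgebra.ad_apply, Module.End.mul_apply] at h3
  change -⁅_, _⁆ = D _ - evalNilpotent _ _ (D c) at h3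
  rw [sub_eq_add_neg, h3]; abel

end LieExp

/-! ### Heights of roots and brackets in the triangular decomposition. -/

section Roots

variable {𝔤 : Type*} [LieRing 𝔤] [LieAlgebra ℂ 𝔤] [FiniteDimensional ℂ 𝔤]
  [LieAlgebra.IsKilling ℂ 𝔤]
  {H : LieSubalgebra ℂ 𝔤} [H.IsCartanSubalgebra]
  (b : (LieAlgebra.IsKilling.rootSystem H).Base)

/-- The element of the Cartan subalgebra on which every root takes the value of its height. -/
def heightElt : H :=
  (Module.evalEquiv ℂ H).symm (b.toWeightBasis.constr ℂ fun _ => (1 : ℂ))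

theorem root_heightElt (i : H.root) :
    (LieAlgebra.IsKilling.rootSystem H).root i (heightElt b) = (b.height i : ℂ) := by
  have h1 : ∀ χ : Module.Dual ℂ H,
      χ (heightElt b) = b.toWeightBasis.constr ℂ (fun _ => (1 : ℂ)) χ := by
    intro χ
    exact Module.apply_evalEquiv_symm_apply ℂ _ χ _
  obtain ⟨g, -, -, hg⟩ := b.exists_root_eq_sum_int i
  rw [RootPairing.Base.height_eq_sum hg, h1, hg, map_sum, Int.cast_sum]
  refine Finset.sum_congr rfl fun j hj => ?_
  have h2 := b.toWeightBasis.constr_basis ℂ (fun _ => (1 : ℂ)) ⟨j, hj⟩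
  rw [RootPairing.Base.toWeightBasis_apply] at h2
  rw [map_zsmul, h2, zsmul_one]

/-- The height of a positive root. -/
def posHeight (α : PosRoot b) : ℕ := (b.height α.1).toNat

theorem posHeight_pos (α : PosRoot b) : 0 < posHeight b α := by
  have := α.2
  rw [RootPairing.Base.isPos_iff] at this
  rw [posHeight]; omega

theorem rootFun_heightElt (α : PosRoot b) : rootFun b α (heightElt b) = (posHeight b α : ℂ) := by
  have h := root_heightElt b α.1
  have := α.2
  rw [RootPairing.Base.isPos_iff] at this
  rw [rootFun, h, posHeight]
  rw [← Int.cast_natCast, Int.toNat_of_nonneg this.le]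

theorem mem_of_mem_rootSpace {χ : H → ℂ} (h0 : χ ≠ 0) {v : 𝔤} (hv : v ∈ LieAlgebra.rootSpace H χ) :
    v = 0 ∨ (∃ α : PosRoot b, χ = rootFun b α) ∨
      ∃ α : PosRoot b, χ = ((-rootFun b α : Module.Dual ℂ H) : H → ℂ) := by
  by_cases hv0 : v = 0
  · exact Or.inl hv0
  right
  have hbot : LieModule.genWeightSpace 𝔤 χ ≠ ⊥ := by
    intro h
    rw [LieAlgebra.rootSpace, h, LieSubmodule.mem_bot] at hv
    exact hv0 hv
  let χ' : LieModule.Weight ℂ H 𝔤 := ⟨χ, hbot⟩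
  have hχ' : ¬ χ'.IsZero := h0
  let P := LieAlgebra.IsKilling.rootSystem H
  let := P.indexNeg
  let r : H.root := ⟨χ', by simpa using hχ'⟩
  rcases RootPairing.Base.IsPos.or_neg b r with hr | hr
  · exact Or.inl ⟨⟨r, hr⟩, rfl⟩
  · refine Or.inr ⟨⟨-r, hr⟩, ?_⟩
    have h1 : P.root (-r) = -P.root r := by simp
    have : -rootFun b ⟨-r, hr⟩ = P.root r := by
      change -(P.root (-r)) = P.root r
      rw [h1, neg_neg]
    rw [this]; rfl

theorem rootSpace_le_nPlus (α : PosRoot b) :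
    (LieAlgebra.rootSpace H (rootFun b α)).toSubmodule ≤ nPlus b :=
  le_iSup (fun α : PosRoot b => (LieAlgebra.rootSpace H (rootFun b α)).toSubmodule) α

theorem rootSpace_le_nMinus (α : PosRoot b) :
    (LieAlgebra.rootSpace H (-rootFun b α : Module.Dual ℂ H)).toSubmodule ≤ nMinus b :=
  le_iSup (fun α : PosRoot b =>
    (LieAlgebra.rootSpace H (-rootFun b α : Module.Dual ℂ H)).toSubmodule) α

/-- The sign of the value at `heightElt b` separates 𝔫, 𝔥 and 𝔫̄, so for brackets of root vectors it
need not be known whether a sum of roots is a root. -/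
theorem mem_nPlus_of_weight {χ : H → ℂ} {n : ℕ} (hn : 0 < n) (hχ : χ (heightElt b) = n) {v : 𝔤}
    (hv : v ∈ LieAlgebra.rootSpace H χ) : v ∈ nPlus b := by
  have h0 : χ ≠ 0 := by
    rintro rfl
    rw [Pi.zero_apply] at hχ
    exact hn.ne (by exact_mod_cast hχ)
  rcases mem_of_mem_rootSpace b h0 hv with rfl | ⟨α, rfl⟩ | ⟨α, rfl⟩
  · exact zero_mem _
  · exact rootSpace_le_nPlus b α hv
  · rw [LinearMap.neg_apply, rootFun_heightElt] at hχ
    have h1 : ((posHeight b α + n : ℕ) : ℂ) = 0 := by push_cast; rw [← hχ]; ring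
    rw [Nat.cast_eq_zero] at h1
    omega

theorem mem_nMinus_of_weight {χ : H → ℂ} {n : ℕ} (hn : 0 < n) (hχ : χ (heightElt b) = -n) {v : 𝔤}
    (hv : v ∈ LieAlgebra.rootSpace H χ) : v ∈ nMinus b := by
  have h0 : χ ≠ 0 := by
    rintro rfl
    rw [Pi.zero_apply, zero_eq_neg] at hχ
    exact hn.ne' (by exact_mod_cast hχ)
  rcases mem_of_mem_rootSpace b h0 hv with rfl | ⟨α, rfl⟩ | ⟨α, rfl⟩
  · exact zero_mem _
  · rw [rootFun_heightElt] at hχ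
    have h1 : ((posHeight b α + n : ℕ) : ℂ) = 0 := by push_cast; rw [hχ]; ring
    rw [Nat.cast_eq_zero] at h1
    omega
  · exact rootSpace_le_nMinus b α hv

theorem nMinus_induction {p : 𝔤 → Prop}
    (mem : ∀ (α : PosRoot b), ∀ y ∈ LieAlgebra.rootSpace H (-rootFun b α : Module.Dual ℂ H), p y)
    (zero : p 0) (add : ∀ y z, p y → p z → p (y + z)) {y : 𝔤} (hy : y ∈ nMinus b) : p y :=
  Submodule.iSup_induction _ (motive := p) hy mem zero add

theorem nPlus_induction {p : 𝔤 → Prop}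
    (mem : ∀ (α : PosRoot b), ∀ y ∈ LieAlgebra.rootSpace H (rootFun b α), p y)
    (zero : p 0) (add : ∀ y z, p y → p z → p (y + z)) {y : 𝔤} (hy : y ∈ nPlus b) : p y :=
  Submodule.iSup_induction _ (motive := p) hy mem zero add

theorem lie_mem_nMinus {y z : 𝔤} (hy : y ∈ nMinus b) (hz : z ∈ nMinus b) : ⁅y, z⁆ ∈ nMinus b := by
  refine nMinus_induction b (p := fun y => ⁅y, z⁆ ∈ nMinus b) (fun α y hy => ?_) (by simp)
    (fun y y' h h' => by rw [add_lie]; exact add_mem h h') hy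
  refine nMinus_induction b (p := fun z => ⁅y, z⁆ ∈ nMinus b) (fun β z hz => ?_) (by simp)
    (fun y y' h h' => by rw [lie_add]; exact add_mem h h') hz
  refine mem_nMinus_of_weight b (n := posHeight b α + posHeight b β)
    (Nat.add_pos_left (posHeight_pos b α) _) ?_
    (LieAlgebra.lie_mem_genWeightSpace_of_mem_genWeightSpace hy hz)
  rw [Pi.add_apply, LinearMap.neg_apply, LinearMap.neg_apply, rootFun_heightElt, rootFun_heightElt]
  push_cast; ring

theorem lie_mem_nPlus {y z : 𝔤} (hy : y ∈ nPlus b) (hz : z ∈ nPlus b) : ⁅y, z⁆ ∈ nPlus b := by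
  refine nPlus_induction b (p := fun y => ⁅y, z⁆ ∈ nPlus b) (fun α y hy => ?_) (by simp)
    (fun y y' h h' => by rw [add_lie]; exact add_mem h h') hy
  refine nPlus_induction b (p := fun z => ⁅y, z⁆ ∈ nPlus b) (fun β z hz => ?_) (by simp)
    (fun y y' h h' => by rw [lie_add]; exact add_mem h h') hz
  refine mem_nPlus_of_weight b (n := posHeight b α + posHeight b β)
    (Nat.add_pos_left (posHeight_pos b α) _) ?_
    (LieAlgebra.lie_mem_genWeightSpace_of_mem_genWeightSpace hy hz)
  rw [Pi.add_apply, rootFun_heightElt, rootFun_heightElt]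
  push_cast; ring

theorem cartan_lie_mem_nMinus (h : H) {y : 𝔤} (hy : y ∈ nMinus b) : ⁅(h : 𝔤), y⁆ ∈ nMinus b := by
  refine nMinus_induction b (p := fun y => ⁅(h : 𝔤), y⁆ ∈ nMinus b) (fun α y hy => ?_) (by simp)
    (fun y y' h h' => by rw [lie_add]; exact add_mem h h') hy
  exact rootSpace_le_nMinus b α (LieSubmodule.lie_mem _ (x := h) hy)

theorem cartan_lie_mem_nPlus (h : H) {y : 𝔤} (hy : y ∈ nPlus b) : ⁅(h : 𝔤), y⁆ ∈ nPlus b := by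
  refine nPlus_induction b (p := fun y => ⁅(h : 𝔤), y⁆ ∈ nPlus b) (fun α y hy => ?_) (by simp)
    (fun y y' h h' => by rw [lie_add]; exact add_mem h h') hy
  exact rootSpace_le_nPlus b α (LieSubmodule.lie_mem _ (x := h) hy)

theorem cartan_lie_cartan (h h' : H) : ⁅(h : 𝔤), (h' : 𝔤)⁆ = 0 := by
  rw [← LieSubalgebra.coe_bracket, trivial_lie_zero H H h h']; rfl

theorem lie_mem_nPlus_of_mem_borel {y z : 𝔤} (hy : y ∈ H.toSubmodule ⊔ nPlus b)
    (hz : z ∈ H.toSubmodule ⊔ nPlus b) : ⁅y, z⁆ ∈ nPlus b := by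
  obtain ⟨h, hh, y, hy', rfl⟩ := Submodule.mem_sup.mp hy
  obtain ⟨h', hh', z, hz', rfl⟩ := Submodule.mem_sup.mp hz
  have h1 : ⁅h, h'⁆ = 0 := cartan_lie_cartan ⟨h, hh⟩ ⟨h', hh'⟩
  have h2 : ⁅h, z⁆ ∈ nPlus b := cartan_lie_mem_nPlus b ⟨h, hh⟩ hz'
  have h3 : ⁅h', y⁆ ∈ nPlus b := cartan_lie_mem_nPlus b ⟨h', hh'⟩ hy'
  rw [add_lie, lie_add, lie_add, h1, zero_add, ← lie_skew y h']
  exact add_mem h2 (add_mem (neg_mem h3) (lie_mem_nPlus b hy' hz'))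

theorem projMinus_of_mem {y : 𝔤} (hy : y ∈ nMinus b) : (projMinus b y : 𝔤) = y := by
  rw [projMinus, Submodule.projectionOnto_apply_of_mem_left _ hy]

theorem projMinus_of_mem_borel {y : 𝔤} (hy : y ∈ H.toSubmodule ⊔ nPlus b) : projMinus b y = 0 :=
  (Submodule.projectionOnto_apply_eq_zero_iff _).mpr hy

theorem projMinus_of_mem_nPlus {y : 𝔤} (hy : y ∈ nPlus b) : projMinus b y = 0 :=
  projMinus_of_mem_borel b (Submodule.mem_sup_right hy)

theorem projCartan_of_mem_nMinus {y : 𝔤} (hy : y ∈ nMinus b) : projCartan b y = 0 :=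
  (Submodule.projectionOnto_apply_eq_zero_iff _).mpr (Submodule.mem_sup_left hy)

theorem projCartan_of_mem_nPlus {y : 𝔤} (hy : y ∈ nPlus b) : projCartan b y = 0 :=
  (Submodule.projectionOnto_apply_eq_zero_iff _).mpr (Submodule.mem_sup_right hy)

theorem projCartan_coe (h : H) : projCartan b (h : 𝔤) = h :=
  Submodule.projectionOnto_apply_left (isCompl_cartan b) h

theorem sub_projMinus_mem (x : 𝔤) : x - projMinus b x ∈ H.toSubmodule ⊔ nPlus b := by
  rw [← Submodule.projectionOnto_apply_eq_zero_iff (isCompl_nMinus b)]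
  change projMinus b (x - projMinus b x) = 0
  rw [map_sub, sub_eq_zero]
  exact (Submodule.projectionOnto_apply_left (isCompl_nMinus b) _).symm

/-- The element is the bracket of x - x_𝔫̄ with y - y_𝔫̄, both in 𝔟, and [𝔟, 𝔟] ⊆ 𝔫. -/
theorem lie_sub_mem_nPlus (x y : 𝔤) :
    ⁅x, y⁆ - (⁅(projMinus b x : 𝔤), y⁆ + ⁅x, (projMinus b y : 𝔤)⁆) +
      ⁅(projMinus b x : 𝔤), (projMinus b y : 𝔤)⁆ ∈ nPlus b := by
  have h := lie_mem_nPlus_of_mem_borel b (sub_projMinus_mem b x) (sub_projMinus_mem b y)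
  rw [sub_lie, lie_sub, lie_sub] at h
  convert h using 1
  abel

/-- The Nijenhuis-type identity of a projection onto a subalgebra along a subalgebra; being
bilinear, it extends to coefficients in ℂ[x]. -/
theorem projMinus_lie (x y : 𝔤) : (projMinus b ⁅x, y⁆ : 𝔤) =
    projMinus b (⁅(projMinus b x : 𝔤), y⁆ + ⁅x, (projMinus b y : 𝔤)⁆) -
      ⁅(projMinus b x : 𝔤), (projMinus b y : 𝔤)⁆ := by
  have h := projMinus_of_mem_nPlus b (lie_sub_mem_nPlus b x y)
  rw [map_add, map_sub] at h
  have h2 := congrArg (Subtype.val) h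
  rw [Submodule.coe_add, Submodule.coe_sub,
    projMinus_of_mem b (lie_mem_nMinus b (projMinus b x).2 (projMinus b y).2)] at h2
  rw [eq_sub_iff_add_eq, ← sub_eq_zero]
  rw [Submodule.coe_zero] at h2
  rw [← h2]
  abel

theorem projCartan_lie (x y : 𝔤) : projCartan b ⁅x, y⁆ =
    projCartan b (⁅(projMinus b x : 𝔤), y⁆ + ⁅x, (projMinus b y : 𝔤)⁆) := by
  have h := projCartan_of_mem_nPlus b (lie_sub_mem_nPlus b x y)
  rw [map_add, map_sub, projCartan_of_mem_nMinus b
    (lie_mem_nMinus b (projMinus b x).2 (projMinus b y).2), add_zero, sub_eq_zero] at h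
  exact h

theorem projMinus_cartan_lie (h : H) (x : 𝔤) :
    (projMinus b ⁅(h : 𝔤), x⁆ : 𝔤) = ⁅(h : 𝔤), (projMinus b x : 𝔤)⁆ := by
  have h1 : projMinus b (h : 𝔤) = 0 := projMinus_of_mem_borel b (Submodule.mem_sup_left h.2)
  rw [projMinus_lie, h1, ZeroMemClass.coe_zero, zero_lie, zero_lie, sub_zero, zero_add,
    projMinus_of_mem b (cartan_lie_mem_nMinus b h (projMinus b x).2)]

section Basis

variable {b} {f : Module.Basis (PosRoot b) ℂ (nMinus b)}
  (hf : ∀ α : PosRoot b, (f α : 𝔤) ∈ LieAlgebra.rootSpace H (-rootFun b α : Module.Dual ℂ H))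
include hf

theorem cartan_lie_basis (h : H) (α : PosRoot b) :
    ⁅(h : 𝔤), (f α : 𝔤)⁆ = (-rootFun b α h) • (f α : 𝔤) := by
  have := LieAlgebra.IsKilling.lie_eq_smul_of_mem_rootSpace (hf α) h
  simpa using this

theorem coord_projMinus_cartan_lie (α : PosRoot b) (h : H) (x : 𝔤) :
    f.coord α (projMinus b ⁅(h : 𝔤), x⁆) = -rootFun b α h * f.coord α (projMinus b x) := by
  have h1 : projMinus b ⁅(h : 𝔤), x⁆ =
      ∑ β, f.coord β (projMinus b x) • (-rootFun b β h) • f β := by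
    apply Subtype.ext
    rw [projMinus_cartan_lie]
    conv_lhs => rw [← f.sum_repr (projMinus b x)]
    push_cast
    rw [lie_sum]
    refine Finset.sum_congr rfl fun β _ => ?_
    rw [lie_smul, cartan_lie_basis hf]; rfl
  rw [h1, map_sum, Finset.sum_eq_single α]
  · simp [mul_comm]
  · intro β _ hβ
    simp [hβ]
  · simp

/-- Both x and f α are eigenvectors of ad h, here with different eigenvalues, and the projection
commutes with ad h. -/
theorem coord_projMinus_of_weight {χ : H → ℂ} {x : 𝔤} (hx : x ∈ LieAlgebra.rootSpace H χ)
    (α : PosRoot b) {h : H} (hχ : χ h ≠ -rootFun b α h) : f.coord α (projMinus b x) = 0 := by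
  have h1 := coord_projMinus_cartan_lie hf α h x
  have h2 := LieAlgebra.IsKilling.lie_eq_smul_of_mem_rootSpace hx h
  have h3 : ⁅(h : 𝔤), x⁆ = χ h • x := h2
  rw [h3, map_smul, map_smul, smul_eq_mul, ← sub_eq_zero, ← sub_mul] at h1
  exact (mul_eq_zero.mp h1).resolve_left (sub_ne_zero.mpr hχ)

end Basis

end Roots

/-! ### Nilpotency of ad u(x). -/

section Nilpotency

variable {𝔤 : Type*} [LieRing 𝔤] [LieAlgebra ℂ 𝔤] [FiniteDimensional ℂ 𝔤]
  [LieAlgebra.IsKilling ℂ 𝔤]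
  {H : LieSubalgebra ℂ 𝔤} [H.IsCartanSubalgebra]
  (b : (LieAlgebra.IsKilling.rootSystem H).Base)

/-- The subspace of `𝔤` of height `j`. -/
def heightSpace (j : ℤ) : Submodule ℂ 𝔤 :=
  Module.End.eigenspace (LieAlgebra.ad ℂ 𝔤 (heightElt b : 𝔤)) (j : ℂ)

theorem rootSpace_le_heightSpace {χ : H → ℂ} {j : ℤ} (hχ : χ (heightElt b) = j) :
    (LieAlgebra.rootSpace H χ).toSubmodule ≤ heightSpace b j := by
  intro v hv
  rw [heightSpace, Module.End.mem_eigenspace_iff, ← hχ]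
  exact LieAlgebra.IsKilling.lie_eq_smul_of_mem_rootSpace hv _

theorem iSup_heightSpace : ⨆ j : ℤ, heightSpace (𝔤 := 𝔤) b j = ⊤ := by
  obtain ⟨-, -, -, -, -, -, -, -, h⟩ := triangular_aux b
  rw [eq_top_iff, ← h]
  refine sup_le (iSup_le fun α => ?_) (sup_le ?_ (iSup_le fun α => ?_))
  · refine le_trans (rootSpace_le_heightSpace b (j := -posHeight b α) ?_) (le_iSup _ _)
    rw [LinearMap.neg_apply, rootFun_heightElt]; simp
  · refine le_trans (fun x hx => ?_) (le_iSup (heightSpace b) 0)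
    rw [heightSpace, Module.End.mem_eigenspace_iff, Int.cast_zero, zero_smul]
    exact cartan_lie_cartan _ ⟨x, hx⟩
  · refine le_trans (rootSpace_le_heightSpace b (j := posHeight b α) ?_) (le_iSup _ _)
    rw [rootFun_heightElt]; simp

theorem lie_mem_heightSpace {α : PosRoot b} {y : 𝔤}
    (hy : y ∈ LieAlgebra.rootSpace H (-rootFun b α : Module.Dual ℂ H)) {j : ℤ} {v : 𝔤}
    (hv : v ∈ heightSpace b j) : ⁅y, v⁆ ∈ heightSpace b (j - posHeight b α) := by
  have h1 : ⁅(heightElt b : 𝔤), y⁆ = (-(posHeight b α : ℂ)) • y := by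
    rw [← rootFun_heightElt]
    exact LieAlgebra.IsKilling.lie_eq_smul_of_mem_rootSpace hy _
  rw [heightSpace, Module.End.mem_eigenspace_iff, LieAlgebra.ad_apply] at hv ⊢
  rw [leibniz_lie, hv, h1, smul_lie, lie_smul, ← add_smul]
  push_cast
  congr 1
  ring

theorem exists_heightSpace_bound :
    ∃ K : ℕ, ∀ j : ℤ, (K : ℤ) < |j| → heightSpace (𝔤 := 𝔤) b j = ⊥ := by
  have hfin := Module.End.finite_hasEigenvalue (LieAlgebra.ad ℂ 𝔤 (heightElt b : 𝔤))
  have hfin2 : Set.Finite {j : ℤ | heightSpace (𝔤 := 𝔤) b j ≠ ⊥} := by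
    refine Set.Finite.of_finite_image (f := fun j : ℤ => (j : ℂ)) (hfin.subset ?_)
      Int.cast_injective.injOn
    rintro _ ⟨j, hj, rfl⟩
    exact hj
  obtain ⟨K, hK⟩ := (hfin2.image (fun j => j.natAbs)).bddAbove
  refine ⟨K, fun j hj => ?_⟩
  by_contra h
  have := hK ⟨j, h, rfl⟩
  simp only at this
  rw [Int.abs_eq_natAbs] at hj
  omega

theorem exists_lowering_filtration : ∃ (F : ℕ → Submodule ℂ 𝔤) (N : ℕ), F 0 = ⊤ ∧ F N = ⊥ ∧
    ∀ (α : PosRoot b), ∀ y ∈ LieAlgebra.rootSpace H (-rootFun b α : Module.Dual ℂ H),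
      ∀ k, ∀ v ∈ F k, ⁅y, v⁆ ∈ F (k + 1) := by
  obtain ⟨K, hK⟩ := exists_heightSpace_bound (𝔤 := 𝔤) b
  -- The k-th step collects the heights at most K - k. All heights lie between -K and K, so step 2K
  -- + 1 is zero.
  refine ⟨fun k => ⨆ j : {j : ℤ // j ≤ K - k}, heightSpace b j, 2 * K + 1, ?_, ?_, ?_⟩
  · rw [eq_top_iff, ← iSup_heightSpace b]
    refine iSup_le fun j => ?_
    by_cases hj : j ≤ K
    · exact le_iSup (fun j : {j : ℤ // j ≤ K - (0 : ℕ)} => heightSpace (𝔤 := 𝔤) b j)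
        ⟨j, by simpa using hj⟩
    · rw [hK j (lt_of_lt_of_le (not_le.mp hj) (le_abs_self j))]
      exact bot_le
  · rw [eq_bot_iff]
    refine iSup_le fun j => ?_
    rw [hK j]
    have := j.2
    push_cast at this
    rw [lt_abs]
    omega
  · intro α y hy k v hv
    refine Submodule.iSup_induction _ (motive := fun v => ⁅y, v⁆ ∈ _) hv (fun j w hw => ?_)
      (by simp) (fun v w h h' => by rw [lie_add]; exact add_mem h h')
    have h1 := posHeight_pos b α
    have h2 := j.2
    exact Submodule.mem_iSup_of_mem
      (⟨j - posHeight b α, by push_cast; omega⟩ : {j : ℤ // j ≤ K - (k + 1 : ℕ)})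
      (lie_mem_heightSpace b hy hw)

variable {b} {f : Module.Basis (PosRoot b) ℂ (nMinus b)}

theorem adU_tmul (r : PolyN b) (y : 𝔤) :
    adU b f (r ⊗ₜ[ℂ] y) =
      ∑ α, ((MvPolynomial.X α : PolyN b) * r) ⊗ₜ[ℂ] ⁅(f α : 𝔤), y⁆ := by
  rw [adU, LieAlgebra.ad_apply, uElt, sum_lie]
  simp only [LieAlgebra.ExtendScalars.bracket_tmul]

variable (hf : ∀ α : PosRoot b, (f α : 𝔤) ∈ LieAlgebra.rootSpace H (-rootFun b α : Module.Dual ℂ H))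
include hf

/-- Each f α lowers the height, so ad u(x) moves down the lowering filtration extended to ℂ[x]. -/
theorem isNilpotent_adU : IsNilpotent (adU b f) := by
  obtain ⟨F, N, h0, hN, hF⟩ := exists_lowering_filtration (𝔤 := 𝔤) b
  have step : ∀ k, ∀ v ∈ (F k).baseChange (PolyN b), adU b f v ∈ (F (k + 1)).baseChange (PolyN b) := by
    intro k v hv
    rw [Submodule.baseChange_eq_span] at hv
    refine Submodule.span_induction ?_ (by rw [map_zero]; exact zero_mem _)
      (fun v w _ _ h h' => by rw [map_add]; exact add_mem h h')
      (fun r v _ h => by rw [map_smul]; exact Submodule.smul_mem _ r h) hv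
    rintro _ ⟨y, hy, rfl⟩
    rw [TensorProduct.mk_apply, adU_tmul]
    exact sum_mem fun α _ => Submodule.tmul_mem_baseChange_of_mem _ (hF α _ (hf α) k y hy)
  have key : ∀ k v, ((adU b f) ^ k) v ∈ (F k).baseChange (PolyN b) := by
    intro k
    induction k with
    | zero => intro v; rw [h0, Submodule.baseChange_top]; trivial
    | succ k ih => intro v; rw [pow_succ', Module.End.mul_apply]; exact step k _ (ih v)
  refine ⟨N, LinearMap.ext fun v => ?_⟩
  have := key N v
  rwa [hN, Submodule.baseChange_bot, Submodule.mem_bot] at this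

theorem isNilpotent_ad_uElt :
    IsNilpotent (LieAlgebra.ad ℂ (PolyN b ⊗[ℂ] 𝔤) (uElt b f)) := by
  obtain ⟨N, hN⟩ := isNilpotent_adU hf
  refine ⟨N, LinearMap.ext fun v => ?_⟩
  have h3 : ∀ n v, ((LieAlgebra.ad ℂ (PolyN b ⊗[ℂ] 𝔤) (uElt b f)) ^ n) v = ((adU b f) ^ n) v := by
    intro n
    induction n with
    | zero => intro v; rfl
    | succ n ih => intro v; rw [pow_succ, pow_succ, Module.End.mul_apply, ih]; rfl
  rw [h3, hN]; rfl

end Nilpotency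

/-! ### Polynomial vector fields in the Weyl algebra. -/

namespace WeylAlg

variable {ι : Type*} [Fintype ι]

theorem derivation_eq_sum_pderiv (D : Derivation ℂ (MvPolynomial ι ℂ) (MvPolynomial ι ℂ))
    (p : MvPolynomial ι ℂ) : D p = ∑ i, D (MvPolynomial.X i) * MvPolynomial.pderiv i p := by
  classical
  have hs : ∀ (F : ι → Derivation ℂ (MvPolynomial ι ℂ) (MvPolynomial ι ℂ)) q,
      (∑ i, F i) q = ∑ i, F i q := fun F q => by
    have := map_sum (Derivation.coeFnAddMonoidHom (R := ℂ) (A := MvPolynomial ι ℂ)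
      (M := MvPolynomial ι ℂ)) F Finset.univ
    exact (congrFun this q).trans (Finset.sum_apply _ _ _)
  have h : D = ∑ i, D (MvPolynomial.X i) • MvPolynomial.pderiv i := by
    refine MvPolynomial.derivation_ext fun j => ?_
    rw [hs, Finset.sum_eq_single j]
    · simp
    · intro i _ hij
      simp [MvPolynomial.pderiv_X_of_ne hij.symm]
    · simp
  conv_lhs => rw [h]
  rw [hs]
  rfl

/-- A polynomial vector field as an element of the Weyl algebra. -/
def ofDerivation (D : Derivation ℂ (MvPolynomial ι ℂ) (MvPolynomial ι ℂ)) : WeylAlg ι :=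
  ∑ i, ofPolyHom (D (MvPolynomial.X i)) * d i

theorem ofDerivation_mul_ofPolyHom (D : Derivation ℂ (MvPolynomial ι ℂ) (MvPolynomial ι ℂ))
    (p : MvPolynomial ι ℂ) :
    ofDerivation D * ofPolyHom p = ofPolyHom p * ofDerivation D + ofPolyHom (D p) := by
  rw [derivation_eq_sum_pderiv D p, ofDerivation, Finset.sum_mul, Finset.mul_sum, map_sum,
    ← Finset.sum_add_distrib]
  refine Finset.sum_congr rfl fun i _ => ?_
  rw [mul_assoc, d_mul_ofPolyHom, mul_add, ← mul_assoc, ← mul_assoc, ← map_mul, ← map_mul,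
    ← map_mul, mul_comm p]

/-- The second-order parts of the two products agree because the d i commute; the first-order parts
give the bracket. -/
theorem ofDerivation_mul_sub (D E : Derivation ℂ (MvPolynomial ι ℂ) (MvPolynomial ι ℂ)) :
    ofDerivation D * ofDerivation E - ofDerivation E * ofDerivation D = ofDerivation ⁅D, E⁆ := by
  have h : ∀ D E : Derivation ℂ (MvPolynomial ι ℂ) (MvPolynomial ι ℂ),
      ofDerivation D * ofDerivation E =
        ∑ i, ∑ j, ofPolyHom (D (MvPolynomial.X j) * E (MvPolynomial.X i)) * (d j * d i) +
          ∑ i, ofPolyHom (D (E (MvPolynomial.X i))) * d i := by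
    intro D E
    conv_lhs => rw [ofDerivation.eq_1 E]
    rw [Finset.mul_sum, ← Finset.sum_add_distrib]
    refine Finset.sum_congr rfl fun i _ => ?_
    rw [← mul_assoc, ofDerivation_mul_ofPolyHom, add_mul, ofDerivation, Finset.mul_sum,
      Finset.sum_mul]
    congr 1
    refine Finset.sum_congr rfl fun j _ => ?_
    rw [mul_comm (D _), map_mul]
    simp only [mul_assoc]
  rw [h D E, h E D]
  have h2 : ∑ i, ∑ j, ofPolyHom (E (MvPolynomial.X j) * D (MvPolynomial.X i)) * (d j * d i) =
      ∑ i, ∑ j, ofPolyHom (D (MvPolynomial.X j) * E (MvPolynomial.X i)) * (d j * d i : WeylAlg ι) := by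
    rw [Finset.sum_comm]
    refine Finset.sum_congr rfl fun i _ => Finset.sum_congr rfl fun j _ => ?_
    rw [d_mul_d, mul_comm]
  rw [h2, add_sub_add_left_eq_sub, ← Finset.sum_sub_distrib, ofDerivation]
  refine Finset.sum_congr rfl fun i _ => ?_
  rw [← sub_mul, ← map_sub, Derivation.commutator_apply]

end WeylAlg

theorem evalNilpotent_mem {R M : Type*} [CommRing R] [Algebra ℂ R] [AddCommGroup M] [Module R M]
    (F : PowerSeries ℂ) (T : Module.End R M) (P : Submodule R M) (hP : ∀ v ∈ P, T v ∈ P) {v : M}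
    (hv : v ∈ P) : evalNilpotent F T v ∈ P := by
  have h : ∀ n, (T ^ n) v ∈ P := by
    intro n
    induction n with
    | zero => exact hv
    | succ n ih => rw [pow_succ', Module.End.mul_apply]; exact hP _ ih
  rw [evalNilpotent, LinearMap.sum_apply]
  exact sum_mem fun n _ => P.smul_mem _ (h n)

/-! ### Derivations of the coefficients acting on e^{-ad u} a in R ⊗ 𝔤. -/

section CoefficientDerivation

variable {R 𝔤 : Type*} [CommRing R] [Algebra ℂ R] [LieRing 𝔤] [LieAlgebra ℂ 𝔤]

/-- The derivation of the Lie algebra `R ⊗ 𝔤` that applies a derivation of `R` to the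
coefficients. -/
def coeffDerivation (D : Derivation ℂ R R) : LieDerivation ℂ (R ⊗[ℂ] 𝔤) (R ⊗[ℂ] 𝔤) where
  toLinearMap := D.toLinearMap.rTensor 𝔤
  leibniz' v w := by
    induction v with
    | zero => simp
    | add v v' hv hv' => rw [add_lie, map_add, hv, hv', map_add, add_lie, lie_add]; abel
    | tmul r x =>
      induction w with
      | zero => simp
      | add w w' hw hw' => rw [lie_add, map_add, hw, hw', map_add, add_lie, lie_add]; abel
      | tmul s y =>
        simp only [LieAlgebra.ExtendScalars.bracket_tmul, LinearMap.rTensor_tmul]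
        change D (r * s) ⊗ₜ[ℂ] ⁅x, y⁆ = (r * D s) ⊗ₜ[ℂ] ⁅x, y⁆ - (s * D r) ⊗ₜ[ℂ] ⁅y, x⁆
        rw [Derivation.leibniz, ← lie_skew y x, TensorProduct.tmul_neg, sub_neg_eq_add,
          TensorProduct.add_tmul, smul_eq_mul, smul_eq_mul]

theorem coeffDerivation_tmul (D : Derivation ℂ R R) (r : R) (x : 𝔤) :
    coeffDerivation D (r ⊗ₜ[ℂ] x) = D r ⊗ₜ[ℂ] x := rfl

theorem coeffDerivation_baseChange (D : Derivation ℂ R R) (g : 𝔤 →ₗ[ℂ] 𝔤) (v : R ⊗[ℂ] 𝔤) :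
    coeffDerivation D (g.baseChange R v) = g.baseChange R (coeffDerivation D v) := by
  induction v with
  | zero => simp
  | add v v' hv hv' => simp only [map_add, hv, hv']
  | tmul r x => simp only [LinearMap.baseChange_tmul, coeffDerivation_tmul]

theorem derivation_dual_baseChange (D : Derivation ℂ R R) (g : Module.Dual ℂ 𝔤) (v : R ⊗[ℂ] 𝔤) :
    D (Module.Dual.baseChange R g v) = Module.Dual.baseChange R g (coeffDerivation D v) := by
  induction v with
  | zero => simp
  | add v v' hv hv' => simp only [map_add, hv, hv']
  | tmul r x =>
    simp only [Module.Dual.baseChange_apply_tmul, coeffDerivation_tmul]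
    exact D.map_smul _ _

theorem coeffDerivation_lie (D E : Derivation ℂ R R) (v : R ⊗[ℂ] 𝔤) :
    coeffDerivation ⁅D, E⁆ v =
      coeffDerivation D (coeffDerivation E v) - coeffDerivation E (coeffDerivation D v) := by
  induction v with
  | zero => simp
  | add v v' hv hv' => simp only [map_add, hv, hv']; abel
  | tmul r x =>
    simp only [coeffDerivation_tmul, Derivation.commutator_apply, TensorProduct.sub_tmul]

theorem coeffDerivation_sub (D E : Derivation ℂ R R) (v : R ⊗[ℂ] 𝔤) :
    coeffDerivation (D - E) v = coeffDerivation D v - coeffDerivation E v := by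
  induction v with
  | zero => simp
  | add v v' hv hv' => simp only [map_add, hv, hv']; abel
  | tmul r x =>
    simp only [coeffDerivation_tmul, Derivation.sub_apply, TensorProduct.sub_tmul]

/-- The components of v with respect to a basis of R are central elements of 𝔤. -/
theorem eq_zero_of_forall_lie_one_tmul {ι : Type*} (B : Module.Basis ι ℂ R)
    (hc : LieAlgebra.center ℂ 𝔤 = ⊥) {v : R ⊗[ℂ] 𝔤}
    (hv : ∀ c : 𝔤, ⁅v, (1 : R) ⊗ₜ[ℂ] c⁆ = 0) : v = 0 := by
  classical
  let e := TensorProduct.equivFinsuppOfBasisLeft B (N := 𝔤)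
  have h : ∀ (w : R ⊗[ℂ] 𝔤) (c : 𝔤) i, e ⁅w, (1 : R) ⊗ₜ[ℂ] c⁆ i = ⁅e w i, c⁆ := by
    intro w c i
    induction w with
    | zero => simp
    | add w w' hw hw' => simp only [map_add, add_lie, Finsupp.add_apply, hw, hw']
    | tmul r x =>
      rw [LieAlgebra.ExtendScalars.bracket_tmul, mul_one]
      simp only [e, TensorProduct.equivFinsuppOfBasisLeft_apply_tmul_apply, smul_lie]
  apply e.injective
  rw [map_zero]
  ext i
  have : e v i ∈ LieAlgebra.center ℂ 𝔤 := by
    rw [LieModule.mem_maxTrivSubmodule]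
    intro c
    rw [← lie_skew, ← h, hv]; simp
  rw [hc, LieSubmodule.mem_bot] at this
  rw [this]; rfl

theorem baseChange_lie {m : 𝔤 →ₗ[ℂ] 𝔤}
    (hm : ∀ x y, m ⁅x, y⁆ = m (⁅m x, y⁆ + ⁅x, m y⁆) - ⁅m x, m y⁆) (v w : R ⊗[ℂ] 𝔤) :
    m.baseChange R ⁅v, w⁆ =
      m.baseChange R (⁅m.baseChange R v, w⁆ + ⁅v, m.baseChange R w⁆) -
        ⁅m.baseChange R v, m.baseChange R w⁆ := by
  induction v with
  | zero => simp
  | add v v' hv hv' => simp only [map_add, add_lie, hv, hv']; abel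
  | tmul r x =>
    induction w with
    | zero => simp
    | add w w' hw hw' => simp only [map_add, lie_add, hw, hw']; abel
    | tmul s y =>
      simp only [LieAlgebra.ExtendScalars.bracket_tmul, LinearMap.baseChange_tmul, map_add,
        ← TensorProduct.tmul_sub, ← TensorProduct.tmul_add]
      rw [hm, map_add]

theorem dual_baseChange_lie {m : 𝔤 →ₗ[ℂ] 𝔤} {g : Module.Dual ℂ 𝔤}
    (hg : ∀ x y, g ⁅x, y⁆ = g (⁅m x, y⁆ + ⁅x, m y⁆)) (v w : R ⊗[ℂ] 𝔤) :
    Module.Dual.baseChange R g ⁅v, w⁆ =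
      Module.Dual.baseChange R g (⁅m.baseChange R v, w⁆ + ⁅v, m.baseChange R w⁆) := by
  induction v with
  | zero => simp
  | add v v' hv hv' => simp only [map_add, add_lie, hv, hv']; abel
  | tmul r x =>
    induction w with
    | zero => simp
    | add w w' hw hw' => simp only [map_add, lie_add, hw, hw']; abel
    | tmul s y =>
      simp only [LieAlgebra.ExtendScalars.bracket_tmul, LinearMap.baseChange_tmul,
        ← TensorProduct.tmul_add, Module.Dual.baseChange_apply_tmul]
      rw [hg]

/-- The element `e^{-ad u} a` of `R ⊗ 𝔤`. -/
def expTwist (u : R ⊗[ℂ] 𝔤) (a : 𝔤) : R ⊗[ℂ] 𝔤 :=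
  evalNilpotent (PowerSeries.exp ℂ) (-LieAlgebra.ad ℂ (R ⊗[ℂ] 𝔤) u) (1 ⊗ₜ[ℂ] a)

theorem evalNilpotent_ad_restrictScalars (F : PowerSeries ℂ) {u : R ⊗[ℂ] 𝔤}
    (hu : IsNilpotent (LieAlgebra.ad R (R ⊗[ℂ] 𝔤) u)) (v : R ⊗[ℂ] 𝔤) :
    evalNilpotent F (LieAlgebra.ad R (R ⊗[ℂ] 𝔤) u) v =
      evalNilpotent F (LieAlgebra.ad ℂ (R ⊗[ℂ] 𝔤) u) v :=
  evalNilpotent_restrictScalars _ hu (fun _ => rfl) _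

theorem evalNilpotent_exp_neg_ad_eq_expTwist {u : R ⊗[ℂ] 𝔤}
    (hu : IsNilpotent (LieAlgebra.ad R (R ⊗[ℂ] 𝔤) u)) (a : 𝔤) :
    evalNilpotent (PowerSeries.exp ℂ) (-LieAlgebra.ad R (R ⊗[ℂ] 𝔤) u) (1 ⊗ₜ[ℂ] a) =
      expTwist u a :=
  evalNilpotent_restrictScalars _ hu.neg (fun _ => rfl) _

variable {u : R ⊗[ℂ] 𝔤} (hu : IsNilpotent (LieAlgebra.ad ℂ (R ⊗[ℂ] 𝔤) u))
include hu

theorem expTwist_lie (a c : 𝔤) : expTwist u ⁅a, c⁆ = ⁅expTwist u a, expTwist u c⁆ := by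
  rw [expTwist, expTwist, expTwist, ← evalNilpotent_exp_neg_lie hu,
    LieAlgebra.ExtendScalars.bracket_tmul, mul_one]

theorem coeffDerivation_expTwist (D : Derivation ℂ R R) (c : 𝔤) :
    coeffDerivation D (expTwist u c) =
      -⁅evalNilpotent maurerCartanSeries (LieAlgebra.ad ℂ (R ⊗[ℂ] 𝔤) u) (coeffDerivation D u),
        expTwist u c⁆ := by
  rw [expTwist, lieDerivation_exp_neg_ad _ hu, coeffDerivation_tmul,
    Derivation.map_one_eq_zero, TensorProduct.zero_tmul, map_zero, zero_sub]

/-- The automorphism e^{ad u} carries `expTwist u c` back to 1 ⊗ c. -/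
theorem eq_zero_of_forall_lie_expTwist {ι : Type*} (B : Module.Basis ι ℂ R)
    (hc : LieAlgebra.center ℂ 𝔤 = ⊥) {v : R ⊗[ℂ] 𝔤} (hv : ∀ c : 𝔤, ⁅v, expTwist u c⁆ = 0) :
    v = 0 := by
  set T := LieAlgebra.ad ℂ (R ⊗[ℂ] 𝔤) u with hT
  have hinv : ∀ w, evalNilpotent (PowerSeries.exp ℂ) T
      (evalNilpotent (PowerSeries.exp ℂ) (-T) w) = w := fun w =>
    LinearMap.congr_fun (evalNilpotent_exp_neg_mul hu) w
  have hinv' : ∀ w, evalNilpotent (PowerSeries.exp ℂ) (-T)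
      (evalNilpotent (PowerSeries.exp ℂ) T w) = w := fun w => by
    have := LinearMap.congr_fun (evalNilpotent_exp_neg_mul hu.neg) w
    rwa [neg_neg] at this
  have h0 : evalNilpotent (PowerSeries.exp ℂ) T v = 0 := by
    apply eq_zero_of_forall_lie_one_tmul B hc
    intro c
    have h1 := hv c
    rw [expTwist] at h1
    rw [← hinv ⁅_, _⁆, evalNilpotent_exp_neg_lie hu, hinv', h1, map_zero]
  rw [← hinv' v, h0, map_zero]

variable {m : 𝔤 →ₗ[ℂ] 𝔤}

/-- The hypothesis hD is the property of the vector field of π(a) from which the bracket relations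
follow; in the application m is the projection onto 𝔫̄. -/
theorem coeffDerivation_expTwist_of_field {D : Derivation ℂ R R} {a : 𝔤}
    (hD : evalNilpotent maurerCartanSeries (LieAlgebra.ad ℂ (R ⊗[ℂ] 𝔤) u) (coeffDerivation D u) =
      -m.baseChange R (expTwist u a)) (c : 𝔤) :
    coeffDerivation D (expTwist u c) = ⁅m.baseChange R (expTwist u a), expTwist u c⁆ := by
  rw [coeffDerivation_expTwist hu, hD, neg_lie, neg_neg]

theorem derivation_dual_expTwist {D E : Derivation ℂ R R} {a c : 𝔤} {g : Module.Dual ℂ 𝔤}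
    (hg : ∀ x y, g ⁅x, y⁆ = g (⁅m x, y⁆ + ⁅x, m y⁆))
    (hD : evalNilpotent maurerCartanSeries (LieAlgebra.ad ℂ (R ⊗[ℂ] 𝔤) u) (coeffDerivation D u) =
      -m.baseChange R (expTwist u a))
    (hE : evalNilpotent maurerCartanSeries (LieAlgebra.ad ℂ (R ⊗[ℂ] 𝔤) u) (coeffDerivation E u) =
      -m.baseChange R (expTwist u c)) :
    D (Module.Dual.baseChange R g (expTwist u c)) - E (Module.Dual.baseChange R g (expTwist u a)) =
      Module.Dual.baseChange R g (expTwist u ⁅a, c⁆) := by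
  rw [derivation_dual_baseChange, derivation_dual_baseChange, ← map_sub,
    coeffDerivation_expTwist_of_field hu hD, coeffDerivation_expTwist_of_field hu hE,
    expTwist_lie hu, dual_baseChange_lie hg, sub_eq_add_neg, lie_skew]

/-- By the derivative formula, the bracket of ((1 - e^{-ad u})/ad u)((⁅D, E⁆ - F) u) with `expTwist
u e` is minus ⁅D, E⁆ - F applied to it. This is explicit and vanishes by the Jacobi identity and hm.
The centre is trivial and the series is invertible, so (⁅D, E⁆ - F) u is itself zero. -/
theorem coeffDerivation_defect_eq_zero {ι : Type*} (B : Module.Basis ι ℂ R)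
    (hc : LieAlgebra.center ℂ 𝔤 = ⊥) {D E F : Derivation ℂ R R} {a c : 𝔤}
    (hm : ∀ x y, m ⁅x, y⁆ = m (⁅m x, y⁆ + ⁅x, m y⁆) - ⁅m x, m y⁆)
    (hD : evalNilpotent maurerCartanSeries (LieAlgebra.ad ℂ (R ⊗[ℂ] 𝔤) u) (coeffDerivation D u) =
      -m.baseChange R (expTwist u a))
    (hE : evalNilpotent maurerCartanSeries (LieAlgebra.ad ℂ (R ⊗[ℂ] 𝔤) u) (coeffDerivation E u) =
      -m.baseChange R (expTwist u c))
    (hF : evalNilpotent maurerCartanSeries (LieAlgebra.ad ℂ (R ⊗[ℂ] 𝔤) u) (coeffDerivation F u) =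
      -m.baseChange R (expTwist u ⁅a, c⁆)) :
    coeffDerivation (⁅D, E⁆ - F) u = 0 := by
  have h1 : evalNilpotent maurerCartanSeries (LieAlgebra.ad ℂ (R ⊗[ℂ] 𝔤) u)
      (coeffDerivation (⁅D, E⁆ - F) u) = 0 := by
    apply eq_zero_of_forall_lie_expTwist hu B hc
    intro e
    rw [← neg_eq_zero, ← coeffDerivation_expTwist hu, coeffDerivation_sub, coeffDerivation_lie,
      coeffDerivation_expTwist_of_field hu hD, coeffDerivation_expTwist_of_field hu hE,
      coeffDerivation_expTwist_of_field hu hF, LieDerivation.apply_lie_eq_add,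
      LieDerivation.apply_lie_eq_add, coeffDerivation_baseChange, coeffDerivation_baseChange,
      coeffDerivation_expTwist_of_field hu hD, coeffDerivation_expTwist_of_field hu hE,
      coeffDerivation_expTwist_of_field hu hD, coeffDerivation_expTwist_of_field hu hE,
      expTwist_lie hu, baseChange_lie hm (expTwist u a)]
    set M := m.baseChange R
    set A := expTwist u a
    set C := expTwist u c
    set E' := expTwist u e
    rw [leibniz_lie (M A) (M C) E', map_add, sub_lie, add_lie, ← lie_skew A (M C), map_neg, neg_lie]
    abel
  have h2 := LinearMap.congr_fun (evalNilpotent_mul (bernoulli'PowerSeries ℂ) maurerCartanSeries hu)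
    (coeffDerivation (⁅D, E⁆ - F) u)
  rw [bernoulli'_mul_maurerCartan, evalNilpotent_one hu, Module.End.mul_apply, h1, map_zero] at h2
  exact h2

end CoefficientDerivation

/-! ### The map π_μ is a homomorphism of Lie algebras. -/

section Homomorphism

variable {𝔤 : Type*} [LieRing 𝔤] [LieAlgebra ℂ 𝔤] [FiniteDimensional ℂ 𝔤]
  [LieAlgebra.IsKilling ℂ 𝔤]
  {H : LieSubalgebra ℂ 𝔤} [H.IsCartanSubalgebra]
  {b : (LieAlgebra.IsKilling.rootSystem H).Base}
  {f : Module.Basis (PosRoot b) ℂ (nMinus b)}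

theorem partMinus_tmul (r : PolyN b) (x : 𝔤) :
    partMinus b (r ⊗ₜ[ℂ] x) = r ⊗ₜ[ℂ] (projMinus b x : 𝔤) := rfl

theorem coordMinus_tmul (α : PosRoot b) (r : PolyN b) (x : 𝔤) :
    coordMinus b f α (r ⊗ₜ[ℂ] x) = f.coord α (projMinus b x) • r := rfl

theorem partMinus_partMinus (v : PolyN b ⊗[ℂ] 𝔤) : partMinus b (partMinus b v) = partMinus b v := by
  induction v with
  | zero => simp
  | add v v' hv hv' => simp only [map_add, hv, hv']
  | tmul r x => rw [partMinus_tmul, partMinus_tmul, projMinus_of_mem b (projMinus b x).2]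

theorem sum_coordMinus_tmul (f : Module.Basis (PosRoot b) ℂ (nMinus b)) (v : PolyN b ⊗[ℂ] 𝔤) :
    ∑ α, coordMinus b f α v ⊗ₜ[ℂ] (f α : 𝔤) = partMinus b v := by
  induction v with
  | zero => simp
  | add v v' hv hv' => simp only [map_add, TensorProduct.add_tmul, Finset.sum_add_distrib, hv, hv']
  | tmul r x =>
    rw [partMinus_tmul]
    conv_rhs => rw [← f.sum_repr (projMinus b x)]
    push_cast
    rw [TensorProduct.tmul_sum]
    refine Finset.sum_congr rfl fun α _ => ?_
    rw [coordMinus_tmul, TensorProduct.smul_tmul]; rfl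

theorem partMinus_adU (v : PolyN b ⊗[ℂ] 𝔤) :
    partMinus b (adU b f (partMinus b v)) = adU b f (partMinus b v) := by
  induction v with
  | zero => simp
  | add v v' hv hv' => simp only [map_add, hv, hv']
  | tmul r x =>
    rw [partMinus_tmul, adU_tmul, map_sum]
    refine Finset.sum_congr rfl fun α _ => ?_
    rw [partMinus_tmul, projMinus_of_mem b (lie_mem_nMinus b (f α).2 (projMinus b x).2)]

/-- The `ℂ[x]`-valued vector `z e^z / (e^z - 1) (e^{-z} a)_𝔫̄`, `z = ad u(x)`. -/
def fieldVec (f : Module.Basis (PosRoot b) ℂ (nMinus b)) (a : 𝔤) : PolyN b ⊗[ℂ] 𝔤 :=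
  evalNilpotent (bernoulli'PowerSeries ℂ) (adU b f) (partMinus b (expNegAdU b f a))

/-- The vector field of `π(a)`. -/
def fieldDerivation (f : Module.Basis (PosRoot b) ℂ (nMinus b)) (a : 𝔤) :
    Derivation ℂ (PolyN b) (PolyN b) :=
  MvPolynomial.mkDerivation ℂ fun α => -coordMinus b f α (fieldVec f a)

theorem fieldDerivation_X (a : 𝔤) (α : PosRoot b) :
    fieldDerivation f a (MvPolynomial.X α) = -coordMinus b f α (fieldVec f a) :=
  MvPolynomial.mkDerivation_X _ _ _

/-- The function part of `π(a)`. -/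
def fieldFun (f : Module.Basis (PosRoot b) ℂ (nMinus b)) (ν : Module.Dual ℂ H) (a : 𝔤) : PolyN b :=
  Module.Dual.baseChange (PolyN b) (ν ∘ₗ projCartan b) (expNegAdU b f a)

theorem piOp_eq (μ : Module.Dual ℂ H) (a : 𝔤) :
    piOp b f μ a = WeylAlg.ofDerivation (fieldDerivation f a) +
      WeylAlg.ofPolyHom (fieldFun f (μ + weylVector b) a) := by
  rw [piOp, WeylAlg.ofDerivation, ← Finset.sum_neg_distrib, WeylAlg.ofPoly_eq]
  congr 1
  refine Finset.sum_congr rfl fun α _ => ?_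
  rw [fieldDerivation_X, map_neg, neg_mul, WeylAlg.ofPoly_eq]
  rfl

theorem partMinus_fieldVec (a : 𝔤) : partMinus b (fieldVec f a) = fieldVec f a := by
  have h := evalNilpotent_mem (bernoulli'PowerSeries ℂ) (adU b f) (LinearMap.range (partMinus b))
    (by rintro _ ⟨v, rfl⟩; exact ⟨_, partMinus_adU v⟩)
    (v := partMinus b (expNegAdU b f a)) ⟨_, rfl⟩
  obtain ⟨w, hw⟩ := h
  rw [fieldVec, ← hw, partMinus_partMinus]

theorem coeffDerivation_uElt (D : Derivation ℂ (PolyN b) (PolyN b)) :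
    coeffDerivation D (uElt b f) = ∑ α, D (MvPolynomial.X α) ⊗ₜ[ℂ] (f α : 𝔤) := by
  rw [uElt, map_sum]; rfl

/-- The vector `fieldVec f a` lies in ℂ[x] ⊗ 𝔫̄, so its coordinates recover it without loss. -/
theorem fieldDerivation_uElt (a : 𝔤) :
    coeffDerivation (fieldDerivation f a) (uElt b f) = -fieldVec f a := by
  rw [coeffDerivation_uElt, ← partMinus_fieldVec, ← sum_coordMinus_tmul f, ← Finset.sum_neg_distrib]
  refine Finset.sum_congr rfl fun α _ => ?_
  rw [fieldDerivation_X, TensorProduct.neg_tmul]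

variable (hf : ∀ α : PosRoot b, (f α : 𝔤) ∈ LieAlgebra.rootSpace H (-rootFun b α : Module.Dual ℂ H))
include hf

theorem expNegAdU_eq (a : 𝔤) : expNegAdU b f a = expTwist (uElt b f) a :=
  evalNilpotent_exp_neg_ad_eq_expTwist (isNilpotent_adU hf) a

theorem maurerCartan_fieldDerivation (a : 𝔤) :
    evalNilpotent maurerCartanSeries (LieAlgebra.ad ℂ (PolyN b ⊗[ℂ] 𝔤) (uElt b f))
      (coeffDerivation (fieldDerivation f a) (uElt b f)) =
    -((nMinus b).subtype ∘ₗ projMinus b).baseChange (PolyN b) (expTwist (uElt b f) a) := by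
  have hn := isNilpotent_adU hf
  have h1 : evalNilpotent maurerCartanSeries (adU b f) (fieldVec f a) =
      partMinus b (expNegAdU b f a) := by
    rw [fieldVec, ← Module.End.mul_apply, ← evalNilpotent_mul _ _ hn, mul_comm,
      bernoulli'_mul_maurerCartan, evalNilpotent_one hn, Module.End.one_apply]
  rw [fieldDerivation_uElt, map_neg, ← expNegAdU_eq hf]
  refine congrArg Neg.neg (Eq.trans ?_ h1)
  exact (evalNilpotent_ad_restrictScalars _ hn _).symm

theorem fieldFun_lie (ν : Module.Dual ℂ H) (a c : 𝔤) :
    fieldDerivation f a (fieldFun f ν c) - fieldDerivation f c (fieldFun f ν a) =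
      fieldFun f ν ⁅a, c⁆ := by
  rw [fieldFun, fieldFun, fieldFun, expNegAdU_eq hf, expNegAdU_eq hf, expNegAdU_eq hf]
  refine derivation_dual_expTwist (isNilpotent_ad_uElt hf) (fun x y => ?_)
    (maurerCartan_fieldDerivation hf a) (maurerCartan_fieldDerivation hf c)
  exact congrArg ν (projCartan_lie b x y)

/-- A derivation of ℂ[x] that annihilates u(x) annihilates all its coordinates x_β, hence is zero.
-/
theorem fieldDerivation_lie (a c : 𝔤) :
    ⁅fieldDerivation f a, fieldDerivation f c⁆ = fieldDerivation f ⁅a, c⁆ := by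
  rw [← sub_eq_zero]
  have h2 := coeffDerivation_defect_eq_zero (isNilpotent_ad_uElt hf)
    (MvPolynomial.basisMonomials (PosRoot b) ℂ) (LieAlgebra.center_eq_bot ℂ 𝔤) (projMinus_lie b)
    (maurerCartan_fieldDerivation hf a) (maurerCartan_fieldDerivation hf c)
    (maurerCartan_fieldDerivation hf ⁅a, c⁆)
  refine MvPolynomial.derivation_ext fun β => ?_
  have h3 := congrArg (coordMinus b f β) h2
  rw [coeffDerivation_uElt, map_sum, map_zero, Finset.sum_eq_single β] at h3
  · rw [coordMinus_tmul, projMinus, Submodule.projectionOnto_apply_left] at h3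
    simpa using h3
  · intro α _ hα
    rw [coordMinus_tmul, projMinus, Submodule.projectionOnto_apply_left]
    simp [hα]
  · simp

theorem piOp_lie (μ : Module.Dual ℂ H) (a c : 𝔤) :
    piOp b f μ ⁅a, c⁆ = piOp b f μ a * piOp b f μ c - piOp b f μ c * piOp b f μ a := by
  simp only [piOp_eq]
  rw [← fieldDerivation_lie hf, ← fieldFun_lie hf, ← WeylAlg.ofDerivation_mul_sub]
  simp only [mul_add, add_mul, WeylAlg.ofDerivation_mul_ofPolyHom, map_sub]
  rw [← map_mul, ← map_mul, mul_comm (fieldFun f _ c)]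
  abel

omit hf in
theorem piOp_add (μ : Module.Dual ℂ H) (a c : 𝔤) :
    piOp b f μ (a + c) = piOp b f μ a + piOp b f μ c := by
  simp only [piOp, expNegAdU, TensorProduct.tmul_add, map_add, add_mul, Finset.sum_add_distrib]
  abel

omit hf in
theorem piOp_smul (μ : Module.Dual ℂ H) (r : ℂ) (a : 𝔤) :
    piOp b f μ (r • a) = r • piOp b f μ a := by
  have h : expNegAdU b f (r • a) = MvPolynomial.C (σ := PosRoot b) r • expNegAdU b f a := by
    rw [expNegAdU, expNegAdU, ← map_smul]
    congr 1
    rw [← TensorProduct.smul_tmul, TensorProduct.smul_tmul', MvPolynomial.smul_eq_C_mul]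
    rfl
  have h2 : ∀ p : PolyN b, WeylAlg.ofPoly (MvPolynomial.C r • p) = r • WeylAlg.ofPoly p := fun p => by
    rw [smul_eq_mul, ← MvPolynomial.smul_eq_C_mul, map_smul]
  simp only [piOp, h, map_smul, h2, smul_add, smul_neg, Finset.smul_sum, smul_mul_assoc]

/-- The Lie algebra homomorphism `π_μ`. -/
def piHom (μ : Module.Dual ℂ H) : 𝔤 →ₗ⁅ℂ⁆ WeylAlg (PosRoot b) where
  toFun := piOp b f μ
  map_add' := piOp_add μ
  map_smul' := piOp_smul μ
  map_lie' := fun {a c} => piOp_lie hf μ a c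

end Homomorphism

/-! ### Generation of an enveloping algebra by its Lie algebra. -/

namespace UniversalEnvelopingAlgebra

variable {L : Type*} [LieRing L] [LieAlgebra ℂ L]

theorem adjoin_range_ι :
    Algebra.adjoin ℂ (Set.range (ι ℂ : L →ₗ⁅ℂ⁆ UniversalEnvelopingAlgebra ℂ L)) = ⊤ := by
  set S := Algebra.adjoin ℂ (Set.range (ι ℂ : L →ₗ⁅ℂ⁆ UniversalEnvelopingAlgebra ℂ L)) with hS
  let φ : L →ₗ⁅ℂ⁆ S :=
    { toFun := fun x => ⟨ι ℂ x, Algebra.subset_adjoin ⟨x, rfl⟩⟩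
      map_add' := fun x y => Subtype.ext (map_add (ι ℂ) x y)
      map_smul' := fun r x => Subtype.ext (map_smul (ι ℂ) r x)
      map_lie' := fun {x y} => Subtype.ext ((ι ℂ).map_lie x y) }
  have h : S.val.comp (lift ℂ φ) = AlgHom.id ℂ _ := by
    apply hom_ext
    ext x
    change ((lift ℂ φ (ι ℂ x) : S) : UniversalEnvelopingAlgebra ℂ L) = ι ℂ x
    rw [lift_ι_apply]
    rfl
  rw [eq_top_iff]
  intro u _
  have h2 := congrArg (fun g => g u) h
  change ((lift ℂ φ u : S) : UniversalEnvelopingAlgebra ℂ L) = u at h2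
  rw [← h2]
  exact (lift ℂ φ u).2

theorem smul_mem_of_forall_ι {V : Type*} [AddCommGroup V] [Module ℂ V]
    [Module (UniversalEnvelopingAlgebra ℂ L) V] [IsScalarTower ℂ (UniversalEnvelopingAlgebra ℂ L) V]
    (P : Submodule ℂ V) (hP : ∀ x : L, ∀ v ∈ P, ι ℂ x • v ∈ P)
    (u : UniversalEnvelopingAlgebra ℂ L) {v : V} (hv : v ∈ P) : u • v ∈ P := by
  let S : Subalgebra ℂ (UniversalEnvelopingAlgebra ℂ L) :=
    { carrier := {u | ∀ v ∈ P, u • v ∈ P}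
      mul_mem' := fun {a b} ha hb v hv => by rw [mul_smul]; exact ha _ (hb v hv)
      add_mem' := fun {a b} ha hb v hv => by rw [add_smul]; exact add_mem (ha v hv) (hb v hv)
      algebraMap_mem' := fun r v hv => by rw [algebraMap_smul]; exact P.smul_mem r hv }
  have hS : S = ⊤ := by
    rw [eq_top_iff, ← adjoin_range_ι, Algebra.adjoin_le_iff]
    rintro _ ⟨x, rfl⟩
    exact hP x
  have : u ∈ S := hS ▸ trivial
  exact this v hv

theorem ι_smul_ι_smul {V : Type*} [AddCommGroup V] [Module (UniversalEnvelopingAlgebra ℂ L) V]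
    (x y : L) (v : V) : (ι ℂ x : UniversalEnvelopingAlgebra ℂ L) • (ι ℂ y : UniversalEnvelopingAlgebra ℂ L) • v =
      (ι ℂ y : UniversalEnvelopingAlgebra ℂ L) • (ι ℂ x : UniversalEnvelopingAlgebra ℂ L) • v +
        (ι ℂ ⁅x, y⁆ : UniversalEnvelopingAlgebra ℂ L) • v := by
  rw [LieHom.map_lie, LieRing.of_associative_ring_bracket, sub_smul, mul_smul, mul_smul]
  abel

end UniversalEnvelopingAlgebra

open UniversalEnvelopingAlgebra

set_option linter.unusedSectionVars false

/-! ### Modules generated from a subspace stable under 𝔟. -/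

section HighestWeight

variable {𝔤 : Type*} [LieRing 𝔤] [LieAlgebra ℂ 𝔤] [FiniteDimensional ℂ 𝔤]
  [LieAlgebra.IsKilling ℂ 𝔤]
  {H : LieSubalgebra ℂ 𝔤} [H.IsCartanSubalgebra]
  (b : (LieAlgebra.IsKilling.rootSystem H).Base)

section Generation

variable {V : Type*} [AddCommGroup V] [Module ℂ V] [Module (UniversalEnvelopingAlgebra ℂ 𝔤) V]
  [IsScalarTower ℂ (UniversalEnvelopingAlgebra ℂ 𝔤) V]

/-- The span of the vectors `y v` with `y ∈ 𝔫̄` and `v` in a given subspace. -/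
def nMinusSpan (P : Submodule ℂ V) : Submodule ℂ V :=
  Submodule.span ℂ {w | ∃ y ∈ nMinus b, ∃ v ∈ P,
    w = (ι ℂ y : UniversalEnvelopingAlgebra ℂ 𝔤) • v}

/-- The span of the products of at most `k` elements of `𝔫̄` with vectors of a given subspace. -/
def nMinusFiltration (X : Submodule ℂ V) : ℕ → Submodule ℂ V
  | 0 => X
  | k + 1 => nMinusFiltration X k ⊔ nMinusSpan b (nMinusFiltration X k)

/-- Moving a ∈ 𝔟 past y ∈ 𝔫̄ costs [a, y]: its 𝔟-part preserves the previous step and its 𝔫̄-part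
leads from there to the present one. -/
theorem ι_smul_mem_nMinusFiltration {X : Submodule ℂ V}
    (hX : ∀ a ∈ H.toSubmodule ⊔ nPlus b, ∀ v ∈ X,
      (ι ℂ a : UniversalEnvelopingAlgebra ℂ 𝔤) • v ∈ X) (k : ℕ) :
    ∀ a ∈ H.toSubmodule ⊔ nPlus b, ∀ v ∈ nMinusFiltration b X k,
      (ι ℂ a : UniversalEnvelopingAlgebra ℂ 𝔤) • v ∈ nMinusFiltration b X k := by
  induction k with
  | zero => exact hX
  | succ k ih =>
    intro a ha v hv
    obtain ⟨v, hv', w, hw, rfl⟩ := Submodule.mem_sup.mp hv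
    rw [smul_add]
    refine add_mem (Submodule.mem_sup_left (ih a ha v hv')) ?_
    have hlow : ∀ y ∈ nMinus b, ∀ v ∈ nMinusFiltration b X k,
        (ι ℂ y : UniversalEnvelopingAlgebra ℂ 𝔤) • v ∈ nMinusFiltration b X (k + 1) :=
      fun y hy v hv => Submodule.mem_sup_right (Submodule.subset_span ⟨y, hy, v, hv, rfl⟩)
    refine Submodule.span_induction ?_ (by rw [smul_zero]; exact zero_mem _)
      (fun v w _ _ h h' => by rw [smul_add]; exact add_mem h h')
      (fun r v _ h => by rw [smul_comm]; exact Submodule.smul_mem _ r h) hw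
    rintro _ ⟨y, hy, v, hv, rfl⟩
    rw [ι_smul_ι_smul]
    refine add_mem (hlow y hy _ (ih a ha v hv)) ?_
    rw [← sub_add_cancel ⁅a, y⁆ (projMinus b ⁅a, y⁆ : 𝔤), map_add, add_smul]
    exact add_mem (Submodule.mem_sup_left (ih _ (sub_projMinus_mem b _) v hv))
      (hlow _ (projMinus b _).2 v hv)

/-- The form in which U(𝔤) = U(𝔫̄)U(𝔟) is used: the union of the filtration generated from X by 𝔫̄
is stable under all of 𝔤 and contains a generator. -/
theorem eq_top_of_borel_stable {X : Submodule ℂ V}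
    (hX : ∀ a ∈ H.toSubmodule ⊔ nPlus b, ∀ v ∈ X,
      (ι ℂ a : UniversalEnvelopingAlgebra ℂ 𝔤) • v ∈ X)
    {v₀ : V} (hv₀ : v₀ ∈ X) (hgen : ∀ v : V, ∃ u : UniversalEnvelopingAlgebra ℂ 𝔤, v = u • v₀)
    {P : Submodule ℂ V} (hXP : X ≤ P)
    (hP : ∀ y ∈ nMinus b, ∀ v ∈ P, (ι ℂ y : UniversalEnvelopingAlgebra ℂ 𝔤) • v ∈ P) :
    P = ⊤ := by
  have hmono : Monotone (nMinusFiltration b X) := monotone_nat_of_le_succ fun k => le_sup_left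
  have hle : ∀ k, nMinusFiltration b X k ≤ P := by
    intro k
    induction k with
    | zero => exact hXP
    | succ k ih =>
      refine sup_le ih (Submodule.span_le.mpr ?_)
      rintro _ ⟨y, hy, v, hv, rfl⟩
      exact hP y hy v (ih hv)
  have hstab : ∀ x : 𝔤, ∀ v ∈ ⨆ k, nMinusFiltration b X k,
      (ι ℂ x : UniversalEnvelopingAlgebra ℂ 𝔤) • v ∈ ⨆ k, nMinusFiltration b X k := by
    intro x v hv
    rw [Submodule.mem_iSup_of_directed _ hmono.directed_le] at hv ⊢
    obtain ⟨k, hk⟩ := hv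
    refine ⟨k + 1, ?_⟩
    rw [← sub_add_cancel x (projMinus b x : 𝔤), map_add, add_smul]
    exact add_mem
      (Submodule.mem_sup_left (ι_smul_mem_nMinusFiltration b hX k _ (sub_projMinus_mem b x) v hk))
      (Submodule.mem_sup_right (Submodule.subset_span ⟨_, (projMinus b x).2, v, hk, rfl⟩))
  rw [eq_top_iff]
  intro v _
  obtain ⟨u, rfl⟩ := hgen v
  exact iSup_le hle (smul_mem_of_forall_ι _ hstab u
    (Submodule.mem_iSup_of_mem 0 hv₀))

end Generation

/-! ### The Harish-Chandra projection. -/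

section HarishChandraProjection

theorem cartanIncl_ι (h : H) : cartanIncl (ι ℂ h) = ι ℂ (h : 𝔤) :=
  lift_ι_apply ℂ _ h

theorem cartan_induction {P : Submodule ℂ (UniversalEnvelopingAlgebra ℂ H)} (h1 : 1 ∈ P)
    (hP : ∀ h : H, ∀ s ∈ P, ι ℂ h * s ∈ P) (s : UniversalEnvelopingAlgebra ℂ H) : s ∈ P := by
  have := smul_mem_of_forall_ι P hP s h1
  rwa [smul_eq_mul, mul_one] at this

/-- The left ideal of `U(𝔤)` generated by `𝔫`. -/
def nPlusIdeal : Submodule (UniversalEnvelopingAlgebra ℂ 𝔤) (UniversalEnvelopingAlgebra ℂ 𝔤) :=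
  Submodule.span _ {w | ∃ y ∈ nPlus b, w = ι ℂ y}

/-- Since 𝔥 normalizes 𝔫, one has 𝔫U(𝔥) ⊆ U(𝔤)𝔫. -/
theorem ι_mul_cartanIncl_mem (s : UniversalEnvelopingAlgebra ℂ H) :
    ∀ y ∈ nPlus b, ι ℂ y * cartanIncl s ∈ nPlusIdeal b := by
  let P : Submodule ℂ (UniversalEnvelopingAlgebra ℂ H) :=
    { carrier := {s | ∀ y ∈ nPlus b, ι ℂ y * cartanIncl s ∈ nPlusIdeal b}
      zero_mem' := fun y _ => by rw [map_zero, mul_zero]; exact zero_mem _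
      add_mem' := fun {s t} hs ht y hy => by
        rw [map_add, mul_add]; exact add_mem (hs y hy) (ht y hy)
      smul_mem' := fun r s hs y hy => by
        rw [map_smul, mul_smul_comm, ← algebraMap_smul (UniversalEnvelopingAlgebra ℂ 𝔤) r]
        exact Submodule.smul_mem _ _ (hs y hy) }
  refine cartan_induction (P := P) (fun y hy => ?_) (fun h s hs y hy => ?_) s
  · rw [map_one, mul_one]; exact Submodule.subset_span ⟨y, hy, rfl⟩
  · have h1 := ι_smul_ι_smul (V := UniversalEnvelopingAlgebra ℂ 𝔤) y (h : 𝔤) (cartanIncl s)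
    rw [map_mul, cartanIncl_ι]
    simp only [smul_eq_mul] at h1
    rw [h1]
    refine add_mem (Submodule.smul_mem _ _ (hs y hy)) (hs _ ?_)
    rw [← lie_skew]
    exact neg_mem (cartan_lie_mem_nPlus b h hy)

theorem nPlusIdeal_le : ∀ w ∈ nPlusIdeal b, w ∈ hcComplement b := by
  intro w hw
  have h : ∀ u, u * w ∈ hcComplement b := by
    refine Submodule.span_induction (p := fun w _ => ∀ u, u * w ∈ hcComplement b) ?_ ?_ ?_ ?_ hw
    · rintro _ ⟨y, hy, rfl⟩ u
      exact Submodule.subset_span (Or.inr ⟨y, hy, u, rfl⟩)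
    · intro u
      rw [mul_zero]; exact zero_mem _
    · intro v w _ _ h h' u
      rw [mul_add]; exact add_mem (h u) (h' u)
    · intro a v _ h u
      rw [smul_eq_mul, ← mul_assoc]; exact h _
  simpa using h 1

/-- In U(𝔤)/U(𝔤)𝔫 the image of U(𝔥) is stable under 𝔟, with 𝔫 acting by zero, and contains the
generator 1; the rest is reached by multiplication with 𝔫̄. -/
theorem exists_hcProj (u : UniversalEnvelopingAlgebra ℂ 𝔤) :
    ∃ s : UniversalEnvelopingAlgebra ℂ H, u - cartanIncl s ∈ hcComplement b := by
  let q := (nPlusIdeal b).mkQ.restrictScalars ℂ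
  have hq : ∀ u v : UniversalEnvelopingAlgebra ℂ 𝔤, u • q v = q (u * v) := fun u v => rfl
  let R := LinearMap.range (cartanIncl (H := H) (𝔤 := 𝔤)).toLinearMap
  have htop : (R ⊔ hcComplement b).map q = ⊤ := by
    refine eq_top_of_borel_stable b (X := R.map q) ?_ (v₀ := q 1) ⟨1, ⟨1, map_one cartanIncl⟩, rfl⟩ ?_
      (Submodule.map_mono le_sup_left) ?_
    · rintro a ha _ ⟨_, ⟨s, rfl⟩, rfl⟩
      obtain ⟨h, hh, y, hy, rfl⟩ := Submodule.mem_sup.mp ha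
      rw [map_add, add_smul, hq, hq]
      have h0 : q (ι ℂ y * cartanIncl s) = 0 :=
        (Submodule.Quotient.mk_eq_zero _).mpr (ι_mul_cartanIncl_mem b s y hy)
      refine add_mem ⟨_, ⟨ι ℂ (⟨h, hh⟩ : H) * s, ?_⟩, rfl⟩ ?_
      · exact (map_mul cartanIncl _ _).trans (by rw [cartanIncl_ι]; rfl)
      · exact h0 ▸ zero_mem _
    · intro v
      obtain ⟨u, rfl⟩ := Submodule.Quotient.mk_surjective _ v
      exact ⟨u, by rw [hq, mul_one]; rfl⟩
    · rintro y hy _ ⟨v, -, rfl⟩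
      exact ⟨_, Submodule.mem_sup_right (Submodule.subset_span (Or.inl ⟨y, hy, v, rfl⟩)), rfl⟩
  have hu : q u ∈ (R ⊔ hcComplement b).map q := htop ▸ trivial
  obtain ⟨w, hw, hwu⟩ := hu
  obtain ⟨_, ⟨s, rfl⟩, c, hc, rfl⟩ := Submodule.mem_sup.mp hw
  refine ⟨s, ?_⟩
  have h1 : u - (cartanIncl s + c) ∈ nPlusIdeal b := by
    rw [← Submodule.Quotient.mk_eq_zero, Submodule.Quotient.mk_sub, sub_eq_zero]
    exact hwu.symm
  have h2 := add_mem (nPlusIdeal_le b _ h1) hc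
  rwa [sub_add_eq_sub_sub, sub_add_cancel] at h2

/-- The only property of p that the argument needs; uniqueness of the component in U(𝔥) does not
enter. -/
theorem sub_hcProj_mem (u : UniversalEnvelopingAlgebra ℂ 𝔤) :
    u - cartanIncl (hcProj b u) ∈ hcComplement b :=
  Classical.epsilon_spec (exists_hcProj b u)

theorem evalDual_rhoShift (lam : Module.Dual ℂ H) (s : UniversalEnvelopingAlgebra ℂ H) :
    evalDual (lam + weylVector b) (rhoShift b s) = evalDual lam s := by
  have h : (evalDual (lam + weylVector b)).comp (rhoShift b) = evalDual lam := by
    apply hom_ext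
    ext x
    change evalDual (lam + weylVector b) (rhoShift b (ι ℂ x)) = evalDual lam (ι ℂ x)
    have h1 : rhoShift b (ι ℂ x) = ι ℂ x - algebraMap ℂ _ (weylVector b x) := lift_ι_apply ℂ _ x
    have h2 : ∀ (μ : Module.Dual ℂ H), evalDual μ (ι ℂ x) = μ x := fun μ => lift_ι_apply ℂ _ x
    rw [h1, map_sub, h2, h2, AlgHom.commutes]
    simp
  exact congrArg (fun g => g s) h

theorem centralChar_eq (lam : Module.Dual ℂ H)
    (z : Subalgebra.center ℂ (UniversalEnvelopingAlgebra ℂ 𝔤)) :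
    centralChar b (lam + weylVector b) z = evalDual lam (hcProj b z) :=
  evalDual_rhoShift b lam _

end HarishChandraProjection

/-! ### The centre on the Verma module. -/

section VermaModule

variable (lam : Module.Dual ℂ H)

/-- The highest weight vector of the Verma module. -/
def vermaVector : Verma b lam := Submodule.Quotient.mk 1

theorem smul_vermaVector (u : UniversalEnvelopingAlgebra ℂ 𝔤) :
    u • vermaVector b lam = Submodule.Quotient.mk u := by
  rw [vermaVector, ← Submodule.Quotient.mk_smul, smul_eq_mul, mul_one]

theorem nPlus_smul_vermaVector {y : 𝔤} (hy : y ∈ nPlus b) :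
    (ι ℂ y : UniversalEnvelopingAlgebra ℂ 𝔤) • vermaVector b lam = 0 := by
  rw [smul_vermaVector, Submodule.Quotient.mk_eq_zero]
  exact Submodule.subset_span (Or.inl ⟨y, hy, rfl⟩)

theorem cartan_smul_vermaVector (h : H) :
    (ι ℂ (h : 𝔤) : UniversalEnvelopingAlgebra ℂ 𝔤) • vermaVector b lam =
      lam h • vermaVector b lam := by
  rw [← algebraMap_smul (UniversalEnvelopingAlgebra ℂ 𝔤) (lam h), ← sub_eq_zero, ← sub_smul,
    smul_vermaVector, Submodule.Quotient.mk_eq_zero]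
  exact Submodule.subset_span (Or.inr ⟨h, rfl⟩)

theorem cartanIncl_smul_vermaVector (s : UniversalEnvelopingAlgebra ℂ H) :
    (cartanIncl s : UniversalEnvelopingAlgebra ℂ 𝔤) • vermaVector b lam =
      evalDual lam s • vermaVector b lam := by
  let P : Submodule ℂ (UniversalEnvelopingAlgebra ℂ H) :=
    { carrier := {s | (cartanIncl s : UniversalEnvelopingAlgebra ℂ 𝔤) • vermaVector b lam =
        evalDual lam s • vermaVector b lam}
      zero_mem' := by simp
      add_mem' := fun {s t} hs ht => by
        rw [Set.mem_ofPred_eq] at hs ht ⊢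
        rw [map_add, map_add, add_smul, add_smul, hs, ht]
      smul_mem' := fun r s hs => by
        rw [Set.mem_ofPred_eq] at hs ⊢
        rw [map_smul, map_smul, smul_assoc, hs, smul_assoc] }
  refine cartan_induction (P := P) ?_ (fun h s hs => ?_) s
  · change cartanIncl 1 • _ = evalDual lam 1 • _
    rw [map_one, map_one, one_smul, one_smul]
  · change cartanIncl (ι ℂ h * s) • _ = evalDual lam (ι ℂ h * s) • _
    have hs' : (cartanIncl s : UniversalEnvelopingAlgebra ℂ 𝔤) • vermaVector b lam =
        evalDual lam s • vermaVector b lam := hs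
    have h2 : evalDual lam (ι ℂ h) = lam h := lift_ι_apply ℂ _ h
    rw [map_mul, map_mul, mul_smul, hs', cartanIncl_ι, h2, smul_comm, cartan_smul_vermaVector,
      smul_smul, mul_comm]

/-- The action of the height element on the Verma module. -/
def vermaHeight : Module.End ℂ (Verma b lam) :=
  Algebra.lsmul ℂ ℂ (Verma b lam) (ι ℂ (heightElt b : 𝔤) : UniversalEnvelopingAlgebra ℂ 𝔤)

/-- The eigenspaces of the height element in the Verma module. -/
def vermaEigenspace (n : ℕ) : Submodule ℂ (Verma b lam) :=
  (vermaHeight b lam).eigenspace (lam (heightElt b) - n)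

theorem mem_vermaEigenspace {n : ℕ} {v : Verma b lam} : v ∈ vermaEigenspace b lam n ↔
    (ι ℂ (heightElt b : 𝔤) : UniversalEnvelopingAlgebra ℂ 𝔤) • v =
      (lam (heightElt b) - n) • v :=
  Module.End.mem_eigenspace_iff

theorem ι_smul_mem_vermaEigenspace {α : PosRoot b} {y : 𝔤}
    (hy : y ∈ LieAlgebra.rootSpace H (-rootFun b α : Module.Dual ℂ H)) {n : ℕ} {v : Verma b lam}
    (hv : v ∈ vermaEigenspace b lam n) :
    (ι ℂ y : UniversalEnvelopingAlgebra ℂ 𝔤) • v ∈ vermaEigenspace b lam (n + posHeight b α) := by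
  have h1 : ⁅(heightElt b : 𝔤), y⁆ = (-(posHeight b α : ℂ)) • y := by
    rw [← rootFun_heightElt]
    exact LieAlgebra.IsKilling.lie_eq_smul_of_mem_rootSpace hy _
  rw [mem_vermaEigenspace] at hv ⊢
  rw [ι_smul_ι_smul, hv, h1, map_smul, smul_assoc, smul_comm, ← add_smul]
  push_cast
  congr 1
  ring

theorem ι_smul_mem_iSup_vermaEigenspace {y : 𝔤} (hy : y ∈ nMinus b) {v : Verma b lam}
    (hv : v ∈ ⨆ n, vermaEigenspace b lam n) :
    (ι ℂ y : UniversalEnvelopingAlgebra ℂ 𝔤) • v ∈ ⨆ n, vermaEigenspace b lam (n + 1) := by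
  refine nMinus_induction b (p := fun y => (ι ℂ y : UniversalEnvelopingAlgebra ℂ 𝔤) • v ∈ _)
    (fun α y hy => ?_) (by rw [map_zero, zero_smul]; exact zero_mem _)
    (fun y z h h' => by rw [map_add, add_smul]; exact add_mem h h') hy
  refine Submodule.iSup_induction _
    (motive := fun v => (ι ℂ y : UniversalEnvelopingAlgebra ℂ 𝔤) • v ∈ _) hv (fun n w hw => ?_)
    (by rw [smul_zero]; exact zero_mem _) (fun v w h h' => by rw [smul_add]; exact add_mem h h')
  -- The family is indexed from the eigenspace of index 1 on; heights of positive roots are at least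
  -- 1, so the subtraction is exact.
  refine Submodule.mem_iSup_of_mem (n + posHeight b α - 1) ?_
  have := posHeight_pos b α
  rw [Nat.sub_add_cancel (by omega)]
  exact ι_smul_mem_vermaEigenspace b lam hy hw

theorem iSup_vermaEigenspace : ⨆ n, vermaEigenspace b lam n = ⊤ := by
  refine eq_top_of_borel_stable b (X := Submodule.span ℂ {vermaVector b lam}) ?_
    (v₀ := vermaVector b lam) (Submodule.mem_span_singleton_self _) ?_ ?_ ?_
  · intro a ha v hv
    obtain ⟨h, hh, y, hy, rfl⟩ := Submodule.mem_sup.mp ha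
    obtain ⟨r, rfl⟩ := Submodule.mem_span_singleton.mp hv
    rw [smul_comm, map_add, add_smul, nPlus_smul_vermaVector b lam hy, add_zero]
    refine Submodule.smul_mem _ _ ?_
    have := cartan_smul_vermaVector b lam ⟨h, hh⟩
    exact this ▸ Submodule.smul_mem _ _ (Submodule.mem_span_singleton_self _)
  · intro v
    obtain ⟨u, rfl⟩ := Submodule.Quotient.mk_surjective _ v
    exact ⟨u, (smul_vermaVector b lam u).symm⟩
  · rw [Submodule.span_singleton_le_iff_mem]
    refine Submodule.mem_iSup_of_mem 0 ?_
    rw [mem_vermaEigenspace, cartan_smul_vermaVector, Nat.cast_zero, sub_zero]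
  · intro y hy v hv
    exact iSup_le (fun n => le_iSup (vermaEigenspace b lam) (n + 1))
      (ι_smul_mem_iSup_vermaEigenspace b lam hy hv)

theorem disjoint_vermaEigenspace :
    Disjoint (vermaEigenspace b lam 0) (⨆ n, vermaEigenspace b lam (n + 1)) := by
  have h := (Module.End.eigenspaces_iSupIndep (vermaHeight b lam)) (lam (heightElt b) - (0 : ℕ))
  refine h.mono_right (iSup_le fun n => ?_)
  refine le_iSup₂_of_le (lam (heightElt b) - (n + 1 : ℕ)) ?_ le_rfl
  intro h
  have h2 : ((n + 1 : ℕ) : ℂ) = 0 := by linear_combination -h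
  exact Nat.succ_ne_zero n (Nat.cast_eq_zero.mp h2)

theorem smul_vermaVector_mem_of_mem_hcComplement {u : UniversalEnvelopingAlgebra ℂ 𝔤}
    (hu : u ∈ hcComplement b) :
    u • vermaVector b lam ∈ ⨆ n, vermaEigenspace b lam (n + 1) := by
  refine Submodule.span_induction ?_ (by rw [zero_smul]; exact zero_mem _)
    (fun v w _ _ h h' => by rw [add_smul]; exact add_mem h h')
    (fun r v _ h => by rw [smul_assoc]; exact Submodule.smul_mem _ r h) hu
  rintro _ (⟨y, hy, w, rfl⟩ | ⟨y, hy, w, rfl⟩)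
  · rw [mul_smul]
    refine ι_smul_mem_iSup_vermaEigenspace b lam hy ?_
    rw [iSup_vermaEigenspace]; trivial
  · rw [mul_smul, nPlus_smul_vermaVector b lam hy, smul_zero]; exact zero_mem _

/-- The difference of the two sides lies in the top eigenspace of the height element, because z
commutes with it, and in the sum of the lower ones, because it is (z - p(z)) applied to the highest
weight vector. -/
theorem center_smul_vermaVector (z : Subalgebra.center ℂ (UniversalEnvelopingAlgebra ℂ 𝔤)) :
    (z : UniversalEnvelopingAlgebra ℂ 𝔤) • vermaVector b lam =
      centralChar b (lam + weylVector b) z • vermaVector b lam := by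
  rw [← sub_eq_zero, centralChar_eq]
  have h1 := smul_vermaVector_mem_of_mem_hcComplement b lam (sub_hcProj_mem b z.1)
  rw [sub_smul, cartanIncl_smul_vermaVector] at h1
  refine Submodule.disjoint_def.mp (disjoint_vermaEigenspace b lam) _ ?_ h1
  have hv : vermaVector b lam ∈ vermaEigenspace b lam 0 := by
    rw [mem_vermaEigenspace, cartan_smul_vermaVector, Nat.cast_zero, sub_zero]
  refine sub_mem ?_ (Submodule.smul_mem _ _ hv)
  rw [mem_vermaEigenspace] at hv ⊢
  rw [← mul_smul, Subalgebra.mem_center_iff.mp z.2 (ι ℂ (heightElt b : 𝔤)), mul_smul, hv, smul_comm]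

/-- Transfers the scalar to any vector of any module that is annihilated by the Verma ideal. -/
theorem center_sub_mem_vermaIdeal (z : Subalgebra.center ℂ (UniversalEnvelopingAlgebra ℂ 𝔤)) :
    (z : UniversalEnvelopingAlgebra ℂ 𝔤) -
      algebraMap ℂ _ (centralChar b (lam + weylVector b) z) ∈ vermaIdeal b lam := by
  rw [← Submodule.Quotient.mk_eq_zero, ← smul_vermaVector, sub_smul, algebraMap_smul,
    center_smul_vermaVector, sub_self]

theorem center_smul_verma (z : Subalgebra.center ℂ (UniversalEnvelopingAlgebra ℂ 𝔤))
    (v : Verma b lam) : (z : UniversalEnvelopingAlgebra ℂ 𝔤) • v =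
      centralChar b (lam + weylVector b) z • v := by
  obtain ⟨u, rfl⟩ := Submodule.Quotient.mk_surjective _ v
  rw [← smul_vermaVector, ← mul_smul, ← (Subalgebra.mem_center_iff.mp z.2 _), mul_smul,
    center_smul_vermaVector, smul_comm]

end VermaModule

end HighestWeight

/-! ### First-order expansion at a point where u vanishes: ε is evaluation there and δ a derivative.
-/

section FirstOrder

variable {R 𝔤 : Type*} [CommRing R] [Algebra ℂ R] [LieRing 𝔤] [LieAlgebra ℂ 𝔤]

/-- The map `R ⊗ 𝔤 → 𝔤` that applies a linear functional to the coefficients. -/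
def evalCoeff (φ : R →ₗ[ℂ] ℂ) : R ⊗[ℂ] 𝔤 →ₗ[ℂ] 𝔤 :=
  (TensorProduct.lid ℂ 𝔤).toLinearMap ∘ₗ φ.rTensor 𝔤

theorem evalCoeff_tmul (φ : R →ₗ[ℂ] ℂ) (r : R) (x : 𝔤) :
    evalCoeff φ (r ⊗ₜ[ℂ] x) = φ r • x := by
  simp [evalCoeff]

theorem evalCoeff_baseChange (φ : R →ₗ[ℂ] ℂ) (m : 𝔤 →ₗ[ℂ] 𝔤) (v : R ⊗[ℂ] 𝔤) :
    evalCoeff φ (m.baseChange R v) = m (evalCoeff φ v) := by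
  induction v with
  | zero => simp
  | add v v' hv hv' => simp only [map_add, hv, hv']
  | tmul r x => rw [LinearMap.baseChange_tmul, evalCoeff_tmul, evalCoeff_tmul, map_smul]

theorem apply_dual_baseChange (φ : R →ₗ[ℂ] ℂ) (g : Module.Dual ℂ 𝔤) (v : R ⊗[ℂ] 𝔤) :
    φ (Module.Dual.baseChange R g v) = g (evalCoeff φ v) := by
  induction v with
  | zero => simp
  | add v v' hv hv' => simp only [map_add, hv, hv']
  | tmul r x =>
    rw [Module.Dual.baseChange_apply_tmul, evalCoeff_tmul, map_smul, map_smul, smul_eq_mul,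
      smul_eq_mul, mul_comm]

variable {ε δ : R →ₗ[ℂ] ℂ} (hε : ∀ r s, ε (r * s) = ε r * ε s)
  (hδ : ∀ r s, δ (r * s) = ε r * δ s + δ r * ε s)

include hε in
theorem evalCoeff_lie (v w : R ⊗[ℂ] 𝔤) : evalCoeff ε ⁅v, w⁆ = ⁅evalCoeff ε v, evalCoeff ε w⁆ := by
  induction v with
  | zero => simp
  | add v v' hv hv' => simp only [map_add, add_lie, hv, hv']
  | tmul r x =>
    induction w with
    | zero => simp
    | add w w' hw hw' => simp only [map_add, lie_add, hw, hw']
    | tmul s y =>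
      simp only [LieAlgebra.ExtendScalars.bracket_tmul, evalCoeff_tmul, hε, smul_lie, lie_smul,
        smul_smul]
      rw [mul_comm]

include hδ in
theorem evalCoeff_derivation_lie (v w : R ⊗[ℂ] 𝔤) :
    evalCoeff δ ⁅v, w⁆ = ⁅evalCoeff ε v, evalCoeff δ w⁆ + ⁅evalCoeff δ v, evalCoeff ε w⁆ := by
  induction v with
  | zero => simp
  | add v v' hv hv' => simp only [map_add, add_lie, hv, hv']; abel
  | tmul r x =>
    induction w with
    | zero => simp
    | add w w' hw hw' => simp only [map_add, lie_add, hw, hw']; abel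
    | tmul s y =>
      simp only [LieAlgebra.ExtendScalars.bracket_tmul, evalCoeff_tmul, hδ, smul_lie, lie_smul,
        smul_smul, add_smul]
      rw [mul_comm (ε r), mul_comm (δ r)]

variable {u : R ⊗[ℂ] 𝔤} (hu : IsNilpotent (LieAlgebra.ad ℂ (R ⊗[ℂ] 𝔤) u)) (hu0 : evalCoeff ε u = 0)

include hε hu0 in
theorem evalCoeff_ad_pow_succ (n : ℕ) (v : R ⊗[ℂ] 𝔤) :
    evalCoeff ε ((LieAlgebra.ad ℂ (R ⊗[ℂ] 𝔤) u ^ (n + 1)) v) = 0 := by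
  rw [pow_succ', Module.End.mul_apply, LieAlgebra.ad_apply, evalCoeff_lie hε, hu0, zero_lie]

include hε hu hu0 in
theorem evalCoeff_evalNilpotent (F : PowerSeries ℂ) (v : R ⊗[ℂ] 𝔤) :
    evalCoeff ε (evalNilpotent F (LieAlgebra.ad ℂ (R ⊗[ℂ] 𝔤) u) v) =
      PowerSeries.coeff 0 F • evalCoeff ε v := by
  obtain ⟨N, hN⟩ := hu
  have hN' := pow_eq_zero_of_le (Nat.le_succ N) hN
  rw [evalNilpotent_apply F hN', map_sum, Finset.sum_range_succ', Finset.sum_eq_zero, zero_add,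
    map_smul]
  · rfl
  · intro n _
    rw [map_smul, evalCoeff_ad_pow_succ hε hu0, smul_zero]

-- Terms of order two or more in u vanish to second order at the point, so only the coefficients 0
-- and 1 of F contribute.
include hε hδ hu hu0 in
theorem evalCoeff_derivation_evalNilpotent (F : PowerSeries ℂ) (v : R ⊗[ℂ] 𝔤) :
    evalCoeff δ (evalNilpotent F (LieAlgebra.ad ℂ (R ⊗[ℂ] 𝔤) u) v) =
      PowerSeries.coeff 0 F • evalCoeff δ v +
        PowerSeries.coeff 1 F • ⁅evalCoeff δ u, evalCoeff ε v⁆ := by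
  obtain ⟨N, hN⟩ := hu
  have hN' : LieAlgebra.ad ℂ (R ⊗[ℂ] 𝔤) u ^ (N + 2) = 0 := pow_eq_zero_of_le (by omega) hN
  rw [evalNilpotent_apply F hN', map_sum, Finset.sum_range_succ', Finset.sum_range_succ',
    Finset.sum_eq_zero, zero_add, map_smul, map_smul, pow_one, pow_zero, LieAlgebra.ad_apply,
    evalCoeff_derivation_lie hδ, hu0, zero_lie, zero_add, add_comm]
  · rw [zero_add]; rfl
  · intro n _
    rw [map_smul, pow_succ', Module.End.mul_apply, LieAlgebra.ad_apply,
      evalCoeff_derivation_lie hδ, evalCoeff_ad_pow_succ hε hu0, hu0, zero_lie, lie_zero, zero_add,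
      smul_zero]

include hε hu hu0 in
theorem evalCoeff_expTwist (h1 : ε 1 = 1) (a : 𝔤) : evalCoeff ε (expTwist u a) = a := by
  rw [expTwist, ← evalNilpotent_evalNegHom _ hu, evalCoeff_evalNilpotent hε hu hu0, evalCoeff_tmul,
    h1, PowerSeries.evalNegHom, PowerSeries.coeff_rescale, PowerSeries.coeff_exp]
  simp

include hε hδ hu hu0 in
theorem evalCoeff_derivation_expTwist (h1 : ε 1 = 1) (a : 𝔤) :
    evalCoeff δ (expTwist u a) = -⁅evalCoeff δ u, a⁆ := by
  have h2 : δ 1 = 0 := by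
    have := hδ 1 1
    rw [one_mul, h1, one_mul, mul_one] at this
    simpa using this
  rw [expTwist, ← evalNilpotent_evalNegHom _ hu,
    evalCoeff_derivation_evalNilpotent hε hδ hu hu0, evalCoeff_tmul, evalCoeff_tmul,
    h1, h2, PowerSeries.evalNegHom, PowerSeries.coeff_rescale, PowerSeries.coeff_rescale,
    PowerSeries.coeff_exp, PowerSeries.coeff_exp]
  simp

end FirstOrder

/-! ### Vector fields and functions applied to the vector 1 of the Fourier representation. -/

namespace WeylAlg

variable {ι : Type*}

/-- The constant coefficient as a linear map. -/
def constCoeff : MvPolynomial ι ℂ →ₗ[ℂ] ℂ where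
  toFun := MvPolynomial.constantCoeff
  map_add' := map_add _
  map_smul' r p := by simp [MvPolynomial.smul_eq_C_mul]

/-- The linear coefficient in one of the variables as a linear map. -/
def linCoeff (i : ι) : MvPolynomial ι ℂ →ₗ[ℂ] ℂ := constCoeff ∘ₗ (MvPolynomial.pderiv i).toLinearMap

theorem constCoeff_mul (p q : MvPolynomial ι ℂ) :
    constCoeff (p * q) = constCoeff p * constCoeff q := map_mul MvPolynomial.constantCoeff p q

theorem linCoeff_mul (i : ι) (p q : MvPolynomial ι ℂ) :
    linCoeff i (p * q) = constCoeff p * linCoeff i q + linCoeff i p * constCoeff q := by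
  change constCoeff (MvPolynomial.pderiv i (p * q)) = _
  rw [Derivation.leibniz, map_add, smul_eq_mul, smul_eq_mul, constCoeff_mul, constCoeff_mul,
    mul_comm (constCoeff q)]
  rfl

theorem constCoeff_one : constCoeff (1 : MvPolynomial ι ℂ) = 1 :=
  map_one MvPolynomial.constantCoeff

theorem fourierRep_ofPolyHom_one (p : MvPolynomial ι ℂ) :
    fourierRep (ofPolyHom p) 1 = MvPolynomial.C (constCoeff p) := by
  induction p using MvPolynomial.induction_on with
  | C a =>
    have : ofPolyHom (MvPolynomial.C a) = algebraMap ℂ (WeylAlg ι) a := ofPolyHom.commutes a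
    rw [this, AlgHom.commutes, Module.algebraMap_end_apply, MvPolynomial.smul_eq_C_mul, mul_one]
    congr 1
    exact (MvPolynomial.constantCoeff_C _ a).symm
  | add p r hp hr => rw [map_add, map_add, LinearMap.add_apply, hp, hr, map_add, map_add]
  | mul_X p j hp =>
    rw [map_mul, map_mul, Module.End.mul_apply, ofPolyHom_X, fourierRep_x, Derivation.map_one_eq_zero,
      neg_zero, map_zero, constCoeff_mul]
    change _ = MvPolynomial.C (_ * MvPolynomial.constantCoeff (MvPolynomial.X j))
    rw [MvPolynomial.constantCoeff_X, mul_zero, map_zero]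

theorem fourierRep_ofDerivation_one [Fintype ι]
    (D : Derivation ℂ (MvPolynomial ι ℂ) (MvPolynomial ι ℂ)) :
    fourierRep (ofDerivation D) 1 =
      ∑ i, (MvPolynomial.X i * MvPolynomial.C (constCoeff (D (MvPolynomial.X i))) -
        MvPolynomial.C (linCoeff i (D (MvPolynomial.X i)))) := by
  rw [ofDerivation, map_sum, LinearMap.sum_apply]
  refine Finset.sum_congr rfl fun i _ => ?_
  -- Moving d i to the left of its coefficient creates minus the divergence of the vector field;
  -- this is the origin of the shift by 2ρ.
  have h := d_mul_ofPolyHom i (D (MvPolynomial.X i))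
  rw [← sub_eq_iff_eq_add] at h
  rw [← h, map_sub, map_mul, LinearMap.sub_apply, Module.End.mul_apply, fourierRep_d,
    fourierRep_ofPolyHom_one, fourierRep_ofPolyHom_one]
  rfl

end WeylAlg

open WeylAlg

/-! ### The highest weight vector 1 and the central character in the Weyl algebra. -/

section CentralCharacter

variable {𝔤 : Type*} [LieRing 𝔤] [LieAlgebra ℂ 𝔤] [FiniteDimensional ℂ 𝔤]
  [LieAlgebra.IsKilling ℂ 𝔤]
  {H : LieSubalgebra ℂ 𝔤} [H.IsCartanSubalgebra]
  {b : (LieAlgebra.IsKilling.rootSystem H).Base}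
  {f : Module.Basis (PosRoot b) ℂ (nMinus b)}

theorem evalCoeff_constCoeff_uElt : evalCoeff constCoeff (uElt b f) = 0 := by
  rw [uElt, map_sum]
  refine Finset.sum_eq_zero fun α _ => (evalCoeff_tmul _ _ _).trans ?_
  have : constCoeff (MvPolynomial.X α : PolyN b) = 0 := MvPolynomial.constantCoeff_X _ α
  rw [this, zero_smul]

theorem evalCoeff_linCoeff_uElt (β : PosRoot b) :
    evalCoeff (linCoeff β) (uElt b f) = (f β : 𝔤) := by
  classical
  have h : ∀ α, linCoeff β (MvPolynomial.X α : PolyN b) = if α = β then 1 else 0 := by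
    intro α
    change constCoeff (MvPolynomial.pderiv β (MvPolynomial.X α)) = _
    rw [MvPolynomial.pderiv_X]
    split_ifs with hα
    · subst hα; rw [Pi.single_eq_same, constCoeff_one]
    · rw [Pi.single_eq_of_ne hα, map_zero]
  rw [uElt, map_sum, Finset.sum_eq_single β]
  · refine (evalCoeff_tmul _ _ _).trans ?_
    rw [h, if_pos rfl, one_smul]
  · intro α _ hα
    refine (evalCoeff_tmul _ _ _).trans ?_
    rw [h, if_neg hα, zero_smul]
  · simp

variable (hf : ∀ α : PosRoot b, (f α : 𝔤) ∈ LieAlgebra.rootSpace H (-rootFun b α : Module.Dual ℂ H))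
include hf

theorem fieldVec_eq (a : 𝔤) : fieldVec f a =
    evalNilpotent (bernoulli'PowerSeries ℂ) (LieAlgebra.ad ℂ (PolyN b ⊗[ℂ] 𝔤) (uElt b f))
      (((nMinus b).subtype ∘ₗ projMinus b).baseChange (PolyN b) (expTwist (uElt b f) a)) := by
  rw [fieldVec, expNegAdU_eq hf]
  exact evalNilpotent_ad_restrictScalars _ (isNilpotent_adU hf) _

theorem evalCoeff_constCoeff_fieldVec (a : 𝔤) :
    evalCoeff constCoeff (fieldVec f a) = projMinus b a := by
  rw [fieldVec_eq hf]
  refine (evalCoeff_evalNilpotent constCoeff_mul (isNilpotent_ad_uElt hf)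
    evalCoeff_constCoeff_uElt _ _).trans ?_
  rw [evalCoeff_baseChange, evalCoeff_expTwist constCoeff_mul (isNilpotent_ad_uElt hf)
    evalCoeff_constCoeff_uElt constCoeff_one]
  simp [bernoulli'PowerSeries]

/-- For a ∈ 𝔟 the vector to which z e^z/(e^z - 1) is applied vanishes at the origin, so the linear
coefficient of that series drops out and only the linear term of e^{-ad u} a counts. -/
theorem evalCoeff_linCoeff_fieldVec {a : 𝔤} (ha : projMinus b a = 0) (β : PosRoot b) :
    evalCoeff (linCoeff β) (fieldVec f a) = -(projMinus b ⁅(f β : 𝔤), a⁆ : 𝔤) := by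
  rw [fieldVec_eq hf]
  refine (evalCoeff_derivation_evalNilpotent constCoeff_mul (linCoeff_mul β) (isNilpotent_ad_uElt hf)
    evalCoeff_constCoeff_uElt _ _).trans ?_
  rw [evalCoeff_baseChange, evalCoeff_baseChange,
    evalCoeff_expTwist constCoeff_mul (isNilpotent_ad_uElt hf)
      evalCoeff_constCoeff_uElt constCoeff_one,
    evalCoeff_derivation_expTwist constCoeff_mul (linCoeff_mul β) (isNilpotent_ad_uElt hf)
      evalCoeff_constCoeff_uElt constCoeff_one, evalCoeff_linCoeff_uElt]
  simp [bernoulli'PowerSeries, ha]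
  rw [← lie_skew, map_neg]
  rfl

theorem constCoeff_fieldDerivation (a : 𝔤) (α : PosRoot b) :
    constCoeff (fieldDerivation f a (MvPolynomial.X α)) = -f.coord α (projMinus b a) := by
  rw [fieldDerivation_X, map_neg]
  congr 1
  refine (apply_dual_baseChange _ _ _).trans ?_
  rw [evalCoeff_constCoeff_fieldVec hf, LinearMap.comp_apply, projMinus,
    Submodule.projectionOnto_apply_left]

theorem linCoeff_fieldDerivation {a : 𝔤} (ha : projMinus b a = 0) (α : PosRoot b) :
    linCoeff α (fieldDerivation f a (MvPolynomial.X α)) =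
      f.coord α (projMinus b ⁅(f α : 𝔤), a⁆) := by
  rw [fieldDerivation_X, map_neg]
  have h : linCoeff α (coordMinus b f α (fieldVec f a)) =
      f.coord α (projMinus b (evalCoeff (linCoeff α) (fieldVec f a))) :=
    apply_dual_baseChange _ _ _
  rw [h, evalCoeff_linCoeff_fieldVec hf ha, map_neg, map_neg, neg_neg]
  congr 1
  exact Submodule.projectionOnto_apply_left (isCompl_nMinus b) _

theorem constCoeff_fieldFun (ν : Module.Dual ℂ H) (a : 𝔤) :
    constCoeff (fieldFun f ν a) = ν (projCartan b a) := by
  rw [fieldFun, expNegAdU_eq hf]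
  refine (apply_dual_baseChange _ _ _).trans ?_
  rw [evalCoeff_expTwist constCoeff_mul (isNilpotent_ad_uElt hf)
    evalCoeff_constCoeff_uElt constCoeff_one]
  rfl

/-- For a ∈ 𝔟 the vector field vanishes at the origin, so no ξ_α appears. Minus its divergence there
is the trace of ad a on 𝔤/𝔟, which is added to the value of the function part. -/
theorem fourierRep_piHom_one (μ : Module.Dual ℂ H) {a : 𝔤} (ha : projMinus b a = 0) :
    fourierRep (piHom hf μ a) 1 = MvPolynomial.C ((μ + weylVector b) (projCartan b a) -
      ∑ α, f.coord α (projMinus b ⁅(f α : 𝔤), a⁆)) := by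
  change fourierRep (piOp b f μ a) 1 = _
  rw [piOp_eq, map_add, LinearMap.add_apply, fourierRep_ofDerivation_one, fourierRep_ofPolyHom_one,
    constCoeff_fieldFun hf, map_sub, map_sum, add_comm, sub_eq_add_neg, ← Finset.sum_neg_distrib]
  congr 1
  refine Finset.sum_congr rfl fun α _ => ?_
  rw [constCoeff_fieldDerivation hf, ha, linCoeff_fieldDerivation hf ha, map_zero, neg_zero,
    map_zero, mul_zero, zero_sub]

/-- Bracketing with 𝔫 raises the height, so every diagonal entry of this trace is zero. -/
theorem fourierRep_piHom_nPlus (μ : Module.Dual ℂ H) {y : 𝔤} (hy : y ∈ nPlus b) :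
    fourierRep (piHom hf μ y) 1 = 0 := by
  have h : ∑ α, f.coord α (projMinus b ⁅(f α : 𝔤), y⁆) = 0 := by
    refine Finset.sum_eq_zero fun α _ => ?_
    refine nPlus_induction b (p := fun y => f.coord α (projMinus b ⁅(f α : 𝔤), y⁆) = 0)
      (fun β y hy => ?_) (by simp)
      (fun y z h h' => by rw [lie_add, map_add, map_add, h, h', add_zero]) hy
    refine coord_projMinus_of_weight hf
      (LieAlgebra.lie_mem_genWeightSpace_of_mem_genWeightSpace (hf α) hy) α
      (h := heightElt b) ?_
    rw [Pi.add_apply, LinearMap.neg_apply, ne_eq, add_eq_left, rootFun_heightElt, Nat.cast_eq_zero]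
    exact (posHeight_pos b β).ne'
  rw [fourierRep_piHom_one hf μ (projMinus_of_mem_nPlus b hy), h, projCartan_of_mem_nPlus b hy,
    map_zero, sub_zero, map_zero]

theorem fourierRep_piHom_cartan (lam : Module.Dual ℂ H) (h : H) :
    fourierRep (piHom hf (lam + weylVector b) (h : 𝔤)) 1 = lam h • 1 := by
  have h1 : ∀ α, f.coord α (projMinus b ⁅(f α : 𝔤), (h : 𝔤)⁆) = rootFun b α h := by
    intro α
    rw [← lie_skew, cartan_lie_basis hf, neg_smul, neg_neg, map_smul, projMinus,
      Submodule.projectionOnto_apply_left]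
    simp
  have h2 : ∑ α, rootFun b α h = 2 * weylVector b h := by
    rw [weylVector]; simp
  rw [fourierRep_piHom_one hf _ (projMinus_of_mem_borel b (Submodule.mem_sup_left h.2)),
    projCartan_coe, Finset.sum_congr rfl fun α _ => h1 α, h2, MvPolynomial.smul_eq_C_mul, mul_one]
  congr 1
  simp only [LinearMap.add_apply]
  ring

theorem exists_piHom_basis_eq (μ : Module.Dual ℂ H) :
    ∃ (p : PosRoot b → PosRoot b → PolyN b) (q : PosRoot b → PolyN b),
      (∀ α β, MvPolynomial.constantCoeff (p α β) = 0) ∧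
      ∀ α, piHom hf μ (f α : 𝔤) = -d α + ∑ β, ofPolyHom (p α β) * d β + ofPolyHom (q α) := by
  classical
  -- At the origin the vector field of f α is -∂_α; adding ∂_α leaves coefficients without constant
  -- term, as `fourierRep_cyclic` requires.
  refine ⟨fun α β => fieldDerivation f (f α : 𝔤) (MvPolynomial.X β) + if β = α then 1 else 0,
    fun α => fieldFun f (μ + weylVector b) (f α : 𝔤), fun α β => ?_, fun α => ?_⟩
  · have h1 := constCoeff_fieldDerivation hf (f α : 𝔤) β
    rw [projMinus, Submodule.projectionOnto_apply_left] at h1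
    change constCoeff (fieldDerivation f (f α : 𝔤) (MvPolynomial.X β) + if β = α then 1 else 0) = 0
    rw [map_add, h1]
    by_cases h : β = α
    · subst h
      rw [if_pos rfl, constCoeff_one]; simp
    · rw [if_neg h, map_zero]
      simp [Ne.symm h]
  · change piOp b f μ _ = _
    rw [piOp_eq, ofDerivation]
    congr 1
    simp only [map_add, add_mul, Finset.sum_add_distrib]
    have h2 : ∑ β, ofPolyHom (if β = α then (1 : PolyN b) else 0) * d β = d α := by
      rw [Finset.sum_eq_single α]
      · rw [if_pos rfl, map_one, one_mul]
      · intro β _ hβ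
        rw [if_neg hβ, map_zero, zero_mul]
      · simp
    rw [h2]; abel

theorem lift_piHom_center (lam : Module.Dual ℂ H)
    (z : Subalgebra.center ℂ (UniversalEnvelopingAlgebra ℂ 𝔤)) :
    UniversalEnvelopingAlgebra.lift ℂ (piHom hf (lam + weylVector b))
        (z : UniversalEnvelopingAlgebra ℂ 𝔤) =
      algebraMap ℂ _ (centralChar b (lam + weylVector b) z) := by
  set ψ : UniversalEnvelopingAlgebra ℂ 𝔤 →ₐ[ℂ] Module.End ℂ (PolyN b) :=
    fourierRep.comp (UniversalEnvelopingAlgebra.lift ℂ (piHom hf (lam + weylVector b))) with hψ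
  have hψι : ∀ a, ψ (ι ℂ a) = fourierRep (piHom hf (lam + weylVector b) a) := fun a => by
    rw [hψ, AlgHom.comp_apply, lift_ι_apply]
  have hker : ∀ w ∈ vermaIdeal b lam, ψ w 1 = 0 := by
    intro w hw
    refine Submodule.span_induction ?_ (by rw [map_zero]; rfl)
      (fun v w _ _ h h' => by rw [map_add, LinearMap.add_apply, h, h', add_zero])
      (fun u v _ h => by rw [smul_eq_mul, map_mul, Module.End.mul_apply, h, map_zero]) hw
    rintro _ (⟨y, hy, rfl⟩ | ⟨h, rfl⟩)
    · rw [hψι, fourierRep_piHom_nPlus hf _ hy]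
    · rw [map_sub, hψι, AlgHom.commutes, LinearMap.sub_apply, fourierRep_piHom_cartan hf,
        Module.algebraMap_end_apply, sub_self]
  set c := centralChar b (lam + weylVector b) z with hc
  have hz1 : ψ z 1 = c • 1 := by
    have := hker _ (center_sub_mem_vermaIdeal b lam z)
    rw [map_sub, AlgHom.commutes, LinearMap.sub_apply, Module.algebraMap_end_apply, sub_eq_zero]
      at this
    exact this
  obtain ⟨p, q, hp, hpq⟩ := exists_piHom_basis_eq hf (lam + weylVector b)
  -- The c-eigenspace of z contains 1 and, z being central, is stable under every π(f_α).
  have htop := fourierRep_cyclic p q hp (LinearMap.ker (ψ z - algebraMap ℂ _ c)) (by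
      rw [LinearMap.mem_ker, LinearMap.sub_apply, hz1, Module.algebraMap_end_apply, sub_self])
    (fun α v hv => by
      rw [LinearMap.mem_ker, LinearMap.sub_apply, Module.algebraMap_end_apply, sub_eq_zero] at hv ⊢
      rw [← hpq, ← hψι, ← Module.End.mul_apply, ← map_mul, ← Subalgebra.mem_center_iff.mp z.2 _,
        map_mul, Module.End.mul_apply, hv, map_smul])
  apply fourierRep_injective
  rw [AlgHom.commutes, ← sub_eq_zero]
  exact LinearMap.ker_eq_top.mp htop

end CentralCharacter

end

theorem mainTheorem3 {𝔤 : Type*} [LieRing 𝔤] [LieAlgebra ℂ 𝔤] [FiniteDimensional ℂ 𝔤]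
    [LieAlgebra.IsSimple ℂ 𝔤] (H : LieSubalgebra ℂ 𝔤) [H.IsCartanSubalgebra]
    (b : (LieAlgebra.IsKilling.rootSystem H).Base)
    (θ : PosRoot b) (hθ : IsMaximalRoot b θ)
    (f : Module.Basis (PosRoot b) ℂ (nMinus b))
    (hf : ∀ α : PosRoot b,
      (f α : 𝔤) ∈ LieAlgebra.rootSpace H (-rootFun b α : Module.Dual ℂ H))
    (lam : Module.Dual ℂ H) :
    (∃ π : 𝔤 →ₗ⁅ℂ⁆ WeylAlg (PosRoot b),
      (∀ a : 𝔤, π a = piOp b f (lam + weylVector b) a) ∧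
      ∀ (z : Subalgebra.center ℂ (UniversalEnvelopingAlgebra ℂ 𝔤)) (v : WModule b θ),
        UniversalEnvelopingAlgebra.lift ℂ π (z : UniversalEnvelopingAlgebra ℂ 𝔤) • v =
          centralChar b (lam + weylVector b) z • v) ∧
    ∀ (z : Subalgebra.center ℂ (UniversalEnvelopingAlgebra ℂ 𝔤)) (v : Verma b lam),
      (z : UniversalEnvelopingAlgebra ℂ 𝔤) • v =
        centralChar b (lam + weylVector b) z • v := by
  refine ⟨⟨piHom hf (lam + weylVector b), fun a => rfl, fun z v => ?_⟩,
    fun z v => center_smul_verma b lam z v⟩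
  -- The image of z is a scalar in 𝒜 before passing to the quotient by the left ideal.
  rw [lift_piHom_center hf lam z, algebraMap_smul]
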